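/- Let $K$ be an algebraically closed field of characteristic $2$. For a quartic surface $X=\{F=0\}\subset\mathbb P^3_K$, let $\mathrm{Sing}(X)$ be the set of points where $F$ and all its partial derivatives vanish; $X$ is called normal if $\mathrm{Sing}(X)$ is finite. (1) Let $X$ be a normal quartic surface with a double point $P$ such that the projection with centre $P$ is an inseparable double cover of $\mathbb P^2$; that is, in suitable linear coordinates $(x,z)=(x_1,x_2,x_3,z)$ with $P=(0,0,0,1)$, where the equation of a quartic with double point $P$ reads $z^2Q(x)+zG(x)+B(x)=0$ with forms $Q\neq 0$, $G$, $B$ of degrees $2,3,4$, one has $G\equiv 0$. Then $|\mathrm{Sing}(X)|\le 16$. If moreover $Q$ is a double line (the square of a nonzero linear form), then $|\mathrm{Sing}(X)|\le 8$; if $Q$ is a pair of distinct lines (a product of two linearly independent linear forms), then $|\mathrm{Sing}(X)|\le 13$. (2) There exist such surfaces with exactly $14$ singular points. Explicitly, for $a_1,a_2,a_3\in K$ put $y_3=a_1x_1+a_2x_2+a_3x_3$ and $$X=\{\,z^2(x_1x_2+x_3^2)+(y_3+x_1)(y_3+x_2)\,y_3\,(y_3+x_1+x_2)=0\,\}.$$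 If $a_1,\ a_2,\ a_3,\ a_1+a_2+a_3\notin\{0,1\}$ (parameters satisfying this exist), then $X$ is a normal quartic surface with a double point at $P=(0,0,0,1)$ of the kind considered in (1), and $|\mathrm{Sing}(X)|=14$. -/

import Mathlib

open MvPolynomial

noncomputable section

namespace QuarticChar2

variable {K : Type*} [Field K]

/-- The singular locus of the surface `{F = 0}` in projective 3-space: the points where `F` and all
its partial derivatives vanish (for homogeneous `F` this does not depend on the representative). -/
def singLocus (F : MvPolynomial (Fin 4) K) : Set (Projectivization K (Fin 4 → K)) :=
  {p | eval p.rep F = 0 ∧ ∀ i, eval p.rep (pderiv i F) = 0}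

/-- `F` defines a normal quartic surface, that is, a quartic surface with finite singular locus. -/
def IsNormalQuartic (F : MvPolynomial (Fin 4) K) : Prop :=
  F ≠ 0 ∧ F.IsHomogeneous 4 ∧ (singLocus F).Finite

/-- The polynomial `F ∘ M` for a square matrix `M`, that is, `v ↦ F (M v)`. -/
def linSubst (M : Matrix (Fin 4) (Fin 4) K) (F : MvPolynomial (Fin 4) K) :
    MvPolynomial (Fin 4) K :=
  bind₁ M.toMvPolynomial F

/-- A form in `x₁, x₂, x₃` (variables `0, 1, 2`), seen as a form in `x₁, x₂, x₃, z`. -/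
def lift4 (f : MvPolynomial (Fin 3) K) : MvPolynomial (Fin 4) K :=
  rename Fin.castSucc f

/-- `z² Q(x) + z G(x) + B(x)`, where `z` is the last variable. -/
def taylorForm (Q G B : MvPolynomial (Fin 3) K) : MvPolynomial (Fin 4) K :=
  X 3 ^ 2 * lift4 Q + X 3 * lift4 G + lift4 B

/-- `P` is a double point of the quartic `{F = 0}`, and in suitable linear coordinates
`(x₁, x₂, x₃, z)` in which `P = (0, 0, 0, 1)`, the equation `F` becomes `z² Q + z G + B` with
forms `Q, G, B` of degrees 2, 3, 4 in `x₁, x₂, x₃`. The multiplicity of `P` is exactly 2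
since there are no terms in `z⁴, z³` and `Q ≠ 0`. -/
def IsDoublePointWith (F : MvPolynomial (Fin 4) K) (P : Projectivization K (Fin 4 → K))
    (Q G B : MvPolynomial (Fin 3) K) : Prop :=
  Q.IsHomogeneous 2 ∧ G.IsHomogeneous 3 ∧ B.IsHomogeneous 4 ∧ Q ≠ 0 ∧
    ∃ g : GL (Fin 4) K,
      (g : Matrix (Fin 4) (Fin 4) K).mulVec (Pi.single 3 1) ∈ P.submodule ∧
      linSubst (g : Matrix (Fin 4) (Fin 4) K) F = taylorForm Q G B

/-- `{Q = 0}` is a double line. -/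
def IsDoubleLine (Q : MvPolynomial (Fin 3) K) : Prop :=
  ∃ l : MvPolynomial (Fin 3) K, l.IsHomogeneous 1 ∧ l ≠ 0 ∧ Q = l ^ 2

/-- `{Q = 0}` is a pair of distinct lines. -/
def IsLinePair (Q : MvPolynomial (Fin 3) K) : Prop :=
  ∃ l m : MvPolynomial (Fin 3) K, l.IsHomogeneous 1 ∧ m.IsHomogeneous 1 ∧
    LinearIndependent K ![l, m] ∧ Q = l * m

/-- The conic `x₁ x₂ + x₃²`. -/
def conic (K : Type*) [Field K] : MvPolynomial (Fin 3) K :=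
  X 0 * X 1 + X 2 ^ 2

/-- The linear form `y₃ = a₁ x₁ + a₂ x₂ + a₃ x₃`. -/
def y3 (a₁ a₂ a₃ : K) : MvPolynomial (Fin 3) K :=
  C a₁ * X 0 + C a₂ * X 1 + C a₃ * X 2

/-- The product `(y₃ + x₁) (y₃ + x₂) y₃ (y₃ + x₁ + x₂)` of four linear forms. -/
def fourLines (a₁ a₂ a₃ : K) : MvPolynomial (Fin 3) K :=
  (y3 a₁ a₂ a₃ + X 0) * (y3 a₁ a₂ a₃ + X 1) * y3 a₁ a₂ a₃ * (y3 a₁ a₂ a₃ + X 0 + X 1)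

/-- The nonempty Zariski open condition on the parameters `a₁, a₂, a₃`. -/
def IsGeneral (a₁ a₂ a₃ : K) : Prop :=
  a₃ ≠ 0 ∧ a₃ ≠ 1 ∧ a₁ ≠ 0 ∧ a₁ ≠ 1 ∧ a₂ ≠ 0 ∧ a₂ ≠ 1 ∧
    a₁ + a₂ + a₃ ≠ 0 ∧ a₁ + a₂ + a₃ ≠ 1

/-- The point `x₁ = x₂ = x₃ = 0`, `z = 1`. -/
def vertex (K : Type*) [Field K] : Projectivization K (Fin 4 → K) :=
  Projectivization.mk K (Pi.single 3 1) (by simp)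

end QuarticChar2

end

noncomputable section

namespace QuarticChar2

open Matrix Module

/-! For `G = 0` in characteristic 2 the `z`-derivative vanishes and only `w = z²` enters: `(x, z)`
is singular iff `w Q + B = 0` and `w ∂ᵢQ + ∂ᵢB = 0` at `x`. If two values of `z` occurred over the
same `x ≠ 0`, the whole line joining that point to `P` would be singular, so finiteness makes the
projection from `P` injective on the other singular points (`IsSingAt.unique`).

Eliminating `w` gives three plane forms `s` that vanish at the projected points. Euler's relation `∑
xᵢ ∂ᵢB = 4B = 0` supplies a syzygy `p ⬝ᵥ s = 0`. Let `deg sᵢ = mᵢ`, `deg pᵢ = D - mᵢ`, and let `s`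
and `p` be free of common factors. Then `s` has at most `D² - D ∑ mᵢ + ∑_{i<j} mᵢ mⱼ` zeros
(`card_zeros_le`). For `p` without zeros this is the second Chern class of the kernel of `p : ⊕
O(mᵢ) → O(D)`, of which `s` is a section. The proof only compares dimensions in one large degree. A
common factor of `s` would produce a curve of zeros, and from it infinitely many singular points.

The numbers are as follows. When `Q` is not a square, its nucleus gives degrees `(5,5,3)` and `D =
6`, hence 13 zeros. A line pair allows the elimination to be divided by the lines: `(4,3,4)` and `D
= 4`, hence 12. For a double line `dQ = 0` and `s = ∇B`: `(3,3,3)` and `D = 4`, hence 7. Adding `P`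
yields 14, 13 and 8, so the claimed 16 holds with room to spare.

In the example the `x₃`-derivative confines singular points to three lines through the nucleus of
the conic. Each line carries four of them outside the nucleus; the point over the nucleus and `P`
itself make 14. -/

/-! ### Ternary forms: dimensions, factors, primitive vectors, separation of points -/

theorem finrank_homogeneousSubmodule {K : Type*} [Field K] (n : ℕ) :
    finrank K (homogeneousSubmodule (Fin 3) K n) = (n + 2).choose 2 := by
  rw [homogeneousSubmodule_eq_finsupp_supported]
  have e : {d : Fin 3 →₀ ℕ | d.degree = n} ≃ Sym (Fin 3) n :=
    (Equiv.subtypeEquivRight (fun d => by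
      simp [Finsupp.degree_apply, Finsupp.sum])).trans (Sym.equivNatSum (Fin 3) n).symm
  have : Fintype {d : Fin 3 →₀ ℕ | d.degree = n} := Fintype.ofEquiv _ e.symm
  rw [(AddMonoidAlgebra.supportedEquivFinsupp (R := K) (S := K)
    {d : Fin 3 →₀ ℕ | d.degree = n}).finrank_eq, finrank_finsupp_self, Fintype.card_congr e,
    Sym.card_sym_eq_choose, Fintype.card_fin, show 3 + n - 1 = n + 2 by omega,
    ← Nat.choose_symm_add]

instance {K : Type*} [Field K] (n : ℕ) : Module.Finite K (homogeneousSubmodule (Fin 3) K n) :=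
  Module.Finite.iff_fg.mpr (homogeneousSubmodule_fg ..)

theorem eq_monomial_of_mul_eq_monomial {R : Type*} [CommRing R] [IsDomain R]
    {f g : Polynomial R} {n : ℕ} {c : R} (hc : c ≠ 0) (h : f * g = Polynomial.monomial n c) :
    f = Polynomial.monomial f.natDegree (f.coeff f.natDegree) := by
  have hne : f * g ≠ 0 := by simpa [h] using hc
  have hf : f ≠ 0 := left_ne_zero_of_mul hne
  have hg : g ≠ 0 := right_ne_zero_of_mul hne
  have h1 := Polynomial.natDegree_mul hf hg
  have h2 := Polynomial.natTrailingDegree_mul hf hg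
  rw [h, Polynomial.natDegree_monomial_eq n hc] at h1
  rw [h, Polynomial.natTrailingDegree_monomial hc] at h2
  have h3 := Polynomial.natTrailingDegree_le_natDegree f
  have h4 := Polynomial.natTrailingDegree_le_natDegree g
  ext k
  rw [Polynomial.coeff_monomial]
  rcases lt_trichotomy k f.natDegree with hk | hk | hk
  · rw [if_neg hk.ne', Polynomial.coeff_eq_zero_of_lt_natTrailingDegree (by omega)]
  · simp [hk]
  · rw [if_neg hk.ne, Polynomial.coeff_eq_zero_of_natDegree_lt hk]

/-- The substitution `X i ↦ X i * T`. -/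
def scaleHom (σ K : Type*) [CommRing K] : MvPolynomial σ K →ₐ[K] Polynomial (MvPolynomial σ K) :=
  aeval fun i => Polynomial.C (X i) * Polynomial.X

theorem scaleHom_of_isHomogeneous {σ K : Type*} [CommRing K] {f : MvPolynomial σ K} {n : ℕ}
    (hf : f.IsHomogeneous n) : scaleHom σ K f = Polynomial.monomial n f := by
  rw [scaleHom, aeval_def, eval₂_eq]
  conv_rhs => rw [f.as_sum, map_sum]
  refine Finset.sum_congr rfl fun d hd => ?_
  have hdeg : ∑ i ∈ d.support, d i = n := by
    simpa [Finsupp.weight_apply, Finsupp.sum] using hf (mem_support_iff.mp hd)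
  rw [monomial_eq, ← Polynomial.C_mul_X_pow_eq_monomial, Finsupp.prod]
  simp only [mul_pow, Finset.prod_mul_distrib, Finset.prod_pow_eq_pow_sum, hdeg, map_mul, map_prod,
    map_pow]
  rw [← mul_assoc]
  rfl

theorem eval_one_scaleHom {σ K : Type*} [CommRing K] (f : MvPolynomial σ K) :
    (scaleHom σ K f).eval 1 = f := by
  induction f using MvPolynomial.induction_on with
  | C a => simp [scaleHom, Polynomial.algebraMap_apply, MvPolynomial.algebraMap_eq]
  | add p q hp hq => simp [hp, hq]
  | mul_X p i hp => rw [map_mul, Polynomial.eval_mul, hp]; simp [scaleHom]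

theorem isHomogeneous_coeff_scaleHom {σ K : Type*} [CommRing K] (f : MvPolynomial σ K) (n : ℕ) :
    ((scaleHom σ K f).coeff n).IsHomogeneous n := by
  rw [← sum_homogeneousComponent f, map_sum, Polynomial.finsetSum_coeff]
  refine IsHomogeneous.sum _ _ _ fun i _ => ?_
  rw [scaleHom_of_isHomogeneous (homogeneousComponent_isHomogeneous i f), Polynomial.coeff_monomial]
  split_ifs with h
  · exact h ▸ homogeneousComponent_isHomogeneous i f
  · exact isHomogeneous_zero ..

/-- Under `X i ↦ X i * T` a form becomes a monomial in `T`; over a domain, factors of a nonzero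
monomial are monomials. -/
theorem IsHomogeneous.exists_of_mul {σ K : Type*} [CommRing K] [IsDomain K]
    {f g : MvPolynomial σ K} {n : ℕ} (h : (f * g).IsHomogeneous n) (h0 : f * g ≠ 0) :
    ∃ m, f.IsHomogeneous m := by
  have h1 := scaleHom_of_isHomogeneous h
  rw [map_mul] at h1
  have h2 := eq_monomial_of_mul_eq_monomial h0 h1
  refine ⟨(scaleHom σ K f).natDegree, ?_⟩
  have h3 : f = (scaleHom σ K f).coeff (scaleHom σ K f).natDegree := by
    conv_lhs => rw [← eval_one_scaleHom f, h2]
    simp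
  have h4 := isHomogeneous_coeff_scaleHom f (scaleHom σ K f).natDegree
  rwa [← h3] at h4

theorem IsHomogeneous.of_mul {σ K : Type*} [CommRing K] [IsDomain K]
    {f g : MvPolynomial σ K} {m n : ℕ} (hg : g.IsHomogeneous m) (h : (f * g).IsHomogeneous (n + m))
    (hg0 : g ≠ 0) : f.IsHomogeneous n := by
  by_cases hf : f = 0
  · exact hf ▸ isHomogeneous_zero ..
  obtain ⟨k, hk⟩ := IsHomogeneous.exists_of_mul h (mul_ne_zero hf hg0)
  have := (hk.mul hg).inj_right h (mul_ne_zero hf hg0)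
  obtain rfl : k = n := by omega
  exact hk

/-- The entries of `s` have no common divisor except units. -/
def IsPrimitiveVec {R : Type*} [CommRing R] (s : Fin 3 → R) : Prop :=
  ∀ d, (∀ i, d ∣ s i) → IsUnit d

/-- From `s k * v j = s j * v k`, the entry `s k` divides every `v k * s j`, hence divides `v k`
times the gcd of the `s j`, which is a unit. The quotient is the required factor. -/
theorem IsPrimitiveVec.exists_smul {R : Type*} [CommRing R] [IsDomain R]
    [UniqueFactorizationMonoid R] {s v : Fin 3 → R} (hs : IsPrimitiveVec s)
    (h : ∀ i j, s i * v j = s j * v i) : ∃ c : R, v = c • s := by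
  classical
  let _ : StrongNormalizationMonoid R := UniqueFactorizationMonoid.strongNormalizationMonoid
  let _ := UniqueFactorizationMonoid.toNormalizedGCDMonoid R
  obtain ⟨k, hk⟩ : ∃ k, s k ≠ 0 := by
    by_contra! h0
    exact not_isUnit_zero (hs 0 fun i => by simp [h0 i])
  have hu : IsUnit (Finset.univ.gcd s) := hs _ fun i => Finset.gcd_dvd (Finset.mem_univ i)
  have h1 : s k ∣ Finset.univ.gcd fun j => v k * s j :=
    Finset.dvd_gcd fun j _ => ⟨v j, by rw [h k j, mul_comm]⟩
  have h2 : s k ∣ v k * 1 :=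
    (h1.trans (Finset.gcd_mul_left' _ _ _).dvd).trans (mul_dvd_mul_left _ hu.dvd)
  rw [mul_one] at h2
  obtain ⟨c, hc⟩ := h2
  refine ⟨c, funext fun j => mul_left_cancel₀ hk ?_⟩
  rw [h k j, hc, Pi.smul_apply, smul_eq_mul]
  ring

theorem isHomogeneous_sum_C_mul_X {K : Type*} [Field K] (c : Fin 3 → K) :
    (∑ k, C (c k) * X k : MvPolynomial (Fin 3) K).IsHomogeneous 1 :=
  IsHomogeneous.sum _ _ _ fun k _ => isHomogeneous_C_mul_X (c k) k

theorem exists_linear_form_separating {K : Type*} [Field K] {u v : Fin 3 → K} (h : u ⨯₃ v ≠ 0) :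
    ∃ l : MvPolynomial (Fin 3) K, l.IsHomogeneous 1 ∧ eval u l = 0 ∧ eval v l ≠ 0 := by
  obtain ⟨k, hk⟩ := Function.ne_iff.mp h
  -- The form sought is `w ↦ (u ⨯₃ w) k`: it vanishes at `u`, and at `v` by the choice of `k` it
  -- does not.
  have key : ∀ w : Fin 3 → K, (Pi.single k 1 ⨯₃ u) ⬝ᵥ w = (u ⨯₃ w) k := fun w => by
    rw [dotProduct_comm, triple_product_permutation, single_one_dotProduct]
  refine ⟨∑ i, C ((Pi.single k 1 ⨯₃ u) i) * X i, isHomogeneous_sum_C_mul_X _, ?_, ?_⟩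
  · simpa [dotProduct] using key u
  · have := key v
    simp only [dotProduct] at this
    simpa [this] using hk

theorem exists_linear_form_ne {K : Type*} [Field K] {v : Fin 3 → K} (h : v ≠ 0) :
    ∃ l : MvPolynomial (Fin 3) K, l.IsHomogeneous 1 ∧ eval v l ≠ 0 := by
  obtain ⟨k, hk⟩ := Function.ne_iff.mp h
  exact ⟨X k, isHomogeneous_X K k, by simpa using hk⟩

/-- Evaluation of forms of degree `d` at a family of points. -/
def evalForms {K ι : Type*} [Field K] (d : ℕ) (v : ι → Fin 3 → K) :
    homogeneousSubmodule (Fin 3) K d →ₗ[K] ι → K :=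
  LinearMap.pi fun i => (aeval (R := K) (v i)).toLinearMap ∘ₗ Submodule.subtype _

theorem evalForms_apply {K ι : Type*} [Field K] {d : ℕ} {v : ι → Fin 3 → K}
    (f : homogeneousSubmodule (Fin 3) K d) (i : ι) : evalForms d v f i = eval (v i) f.1 := by
  simp [evalForms, aeval_eq_eval]

/-- Points impose independent conditions once the degree reaches their number: a product of linear
forms through all points but one, padded by a form nonzero at that one, is a multiple of a delta
function. -/
theorem evalForms_surjective {K ι : Type*} [Field K] [Fintype ι] {d : ℕ} {v : ι → Fin 3 → K}
    (hd : Fintype.card ι ≤ d) (h0 : ∀ i, v i ≠ 0) (h : ∀ i j, i ≠ j → v i ⨯₃ v j ≠ 0) :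
    Function.Surjective (evalForms d v) := by
  classical
  have key : ∀ i, ∃ f : homogeneousSubmodule (Fin 3) K d, evalForms d v f = Pi.single i 1 := by
    intro i
    obtain ⟨l, hl, hl0⟩ := exists_linear_form_ne (h0 i)
    have : ∀ j, ∃ m : MvPolynomial (Fin 3) K, m.IsHomogeneous 1 ∧ eval (v i) m ≠ 0 ∧
        (j ≠ i → eval (v j) m = 0) := fun j => by
      by_cases hj : j = i
      · exact ⟨l, hl, hl0, fun h => absurd hj h⟩
      · obtain ⟨m, h1, h2, h3⟩ := exists_linear_form_separating (h j i hj)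
        exact ⟨m, h1, h3, fun _ => h2⟩
    choose m hm1 hm2 hm3 using this
    set f := (∏ j, m j) * l ^ (d - Fintype.card ι) with hf
    have hfd : f.IsHomogeneous d := by
      have h1 := (IsHomogeneous.prod Finset.univ m (fun _ => 1) fun j _ => hm1 j).mul
        (hl.pow (d - Fintype.card ι))
      simpa [Nat.add_sub_cancel' hd] using h1
    have hfi : eval (v i) f ≠ 0 := by
      rw [hf, map_mul, map_prod, map_pow]
      exact mul_ne_zero (Finset.prod_ne_zero_iff.mpr fun j _ => hm2 j) (pow_ne_zero _ hl0)
    refine ⟨(eval (v i) f)⁻¹ • ⟨f, hfd⟩, funext fun j => ?_⟩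
    rw [map_smul, Pi.smul_apply, evalForms_apply, smul_eq_mul]
    by_cases hj : j = i
    · subst hj
      rw [Pi.single_eq_same, inv_mul_cancel₀ hfi]
    · have hfj : eval (v j) f = 0 := by
        rw [hf, map_mul, map_prod, Finset.prod_eq_zero (Finset.mem_univ j) (hm3 j hj), zero_mul]
      rw [Pi.single_eq_of_ne hj]
      exact mul_eq_zero_of_right _ hfj
  rw [← LinearMap.range_eq_top, eq_top_iff, ← (Pi.basisFun K ι).span_eq, Submodule.span_le]
  rintro _ ⟨i, rfl⟩
  obtain ⟨f, hf⟩ := key i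
  exact ⟨f, by rw [hf, Pi.basisFun_apply]⟩

/-- Both `p` and `a` are orthogonal to `s`, so `p ⨯₃ a` is parallel to `s`. -/
theorem mul_cross_comm {R : Type*} [CommRing R] {p a s : Fin 3 → R} (hsp : p ⬝ᵥ s = 0)
    (ha : ∑ i, a i * s i = 0) (i j : Fin 3) : s i * (p ⨯₃ a) j = s j * (p ⨯₃ a) i := by
  simp only [Fin.sum_univ_three] at ha
  simp only [dotProduct, Fin.sum_univ_three] at hsp
  rw [cross_apply]
  fin_cases i <;> fin_cases j <;> simp <;> grind

theorem mul_comm_of_cross_eq_zero {R : Type*} [CommRing R] {p a : Fin 3 → R} (h : p ⨯₃ a = 0)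
    (i j : Fin 3) : p i * a j = p j * a i := by
  have c0 := congrFun h 0
  have c1 := congrFun h 1
  have c2 := congrFun h 2
  simp [cross_apply] at c0 c1 c2
  fin_cases i <;> fin_cases j <;> simp <;> grind

/-! ### Counting the common zeros of three forms with a syzygy -/

section Count

variable {K : Type*} [Field K]

/-- The map `(a₀, a₁, a₂) ↦ a₀ s₀ + a₁ s₁ + a₂ s₂`. -/
def combMap (s : Fin 3 → MvPolynomial (Fin 3) K) (e : Fin 3 → ℕ) :
    (∀ i, homogeneousSubmodule (Fin 3) K (e i)) →ₗ[K] MvPolynomial (Fin 3) K :=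
  ∑ i, (LinearMap.mulRight K (s i)) ∘ₗ Submodule.subtype _ ∘ₗ LinearMap.proj i

theorem combMap_apply (s : Fin 3 → MvPolynomial (Fin 3) K) (e : Fin 3 → ℕ)
    (a : ∀ i, homogeneousSubmodule (Fin 3) K (e i)) : combMap s e a = ∑ i, (a i).1 * s i := by
  simp [combMap]

/-- The map `(a₀, a₁, a₂) ↦ p × a`. -/
def crossMap (p : Fin 3 → MvPolynomial (Fin 3) K) (e : Fin 3 → ℕ) :
    (∀ i, homogeneousSubmodule (Fin 3) K (e i)) →ₗ[K] Fin 3 → MvPolynomial (Fin 3) K :=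
  (crossProduct p).restrictScalars K ∘ₗ
    LinearMap.pi fun i => Submodule.subtype _ ∘ₗ LinearMap.proj i

theorem crossMap_apply (p : Fin 3 → MvPolynomial (Fin 3) K) (e : Fin 3 → ℕ)
    (a : ∀ i, homogeneousSubmodule (Fin 3) K (e i)) : crossMap p e a = p ⨯₃ fun i => (a i).1 :=
  rfl

/-- The vectors `c • s` for forms `c` of degree `n`. -/
def formMultiples (s : Fin 3 → MvPolynomial (Fin 3) K) (n : ℕ) :
    Submodule K (Fin 3 → MvPolynomial (Fin 3) K) :=
  (homogeneousSubmodule (Fin 3) K n).map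
    ((LinearMap.toSpanSingleton (MvPolynomial (Fin 3) K) _ s).restrictScalars K)

theorem mem_formMultiples {s v : Fin 3 → MvPolynomial (Fin 3) K} {n : ℕ} :
    v ∈ formMultiples s n ↔ ∃ c : MvPolynomial (Fin 3) K, c.IsHomogeneous n ∧ c • s = v := by
  simp [formMultiples, Submodule.mem_map]

theorem finrank_formMultiples_le (s : Fin 3 → MvPolynomial (Fin 3) K) (n : ℕ) :
    finrank K (formMultiples s n) ≤ (n + 2).choose 2 :=
  (Submodule.finrank_map_le _ _).trans (finrank_homogeneousSubmodule n).le

instance (s : Fin 3 → MvPolynomial (Fin 3) K) (n : ℕ) : Module.Finite K (formMultiples s n) := by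
  unfold formMultiples; infer_instance

theorem IsPrimitiveVec.mem_formMultiples {s v : Fin 3 → MvPolynomial (Fin 3) K}
    (hs : IsPrimitiveVec s) {m : Fin 3 → ℕ} {n : ℕ} (hm : ∀ i, (s i).IsHomogeneous (m i))
    (hv : ∀ i, (v i).IsHomogeneous (n + m i)) (h : ∀ i j, s i * v j = s j * v i) :
    v ∈ formMultiples s n := by
  obtain ⟨c, rfl⟩ := hs.exists_smul h
  obtain ⟨k, hk⟩ : ∃ k, s k ≠ 0 := by
    by_contra! h0
    exact not_isUnit_zero (hs 0 fun i => by simp [h0 i])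
  exact QuarticChar2.mem_formMultiples.mpr ⟨c, IsHomogeneous.of_mul (hm k) (hv k) hk, rfl⟩

/-- The degree-`d` part of the ideal of `s` lies in the kernel of evaluation at the zeros, whose
codimension is the number of zeros. -/
theorem finrank_range_combMap_add_le {s : Fin 3 → MvPolynomial (Fin 3) K} {m : Fin 3 → ℕ} {d : ℕ}
    (hm : ∀ i, (s i).IsHomogeneous (m i)) (hmd : ∀ i, m i ≤ d)
    {ι : Type*} [Fintype ι] {v : ι → Fin 3 → K} (h0 : ∀ i, v i ≠ 0)
    (hv : ∀ i j, i ≠ j → v i ⨯₃ v j ≠ 0) (hz : ∀ i j, eval (v i) (s j) = 0)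
    (hd : Fintype.card ι ≤ d) :
    Fintype.card ι + finrank K (LinearMap.range (combMap s fun i => d - m i)) ≤
      (d + 2).choose 2 := by
  have h1 := LinearMap.finrank_range_add_finrank_ker (evalForms d v)
  rw [LinearMap.range_eq_top.mpr (evalForms_surjective hd h0 hv), finrank_top,
    finrank_fintype_fun_eq_card, finrank_homogeneousSubmodule] at h1
  have h2 : LinearMap.range (combMap s fun i => d - m i) ≤
      (LinearMap.ker (evalForms d v)).map (Submodule.subtype _) := by
    rintro _ ⟨a, rfl⟩
    have hh : (combMap s _ a).IsHomogeneous d := by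
      rw [combMap_apply]
      refine IsHomogeneous.sum _ _ _ fun i _ => ?_
      have := (show (a i).1.IsHomogeneous (d - m i) from (a i).2).mul (hm i)
      rwa [Nat.sub_add_cancel (hmd i)] at this
    refine ⟨⟨_, hh⟩, ?_, rfl⟩
    rw [SetLike.mem_coe, LinearMap.mem_ker]
    ext i
    rw [evalForms_apply]
    change eval (v i) (combMap s _ a) = 0
    rw [combMap_apply]
    simp [hz]
  have h3 := (Submodule.finrank_mono h2).trans (Submodule.finrank_map_le _ _)
  omega

/-- Rank–nullity for `a ↦ p ⨯₃ a` on the syzygies of `s`. Its values are parallel to `s`, hence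
multiples of `s` by forms of degree `d + D - ∑ mᵢ`. Its kernel consists of vectors parallel to `p`,
hence multiples of `p` by forms of degree `d - D`. -/
theorem finrank_ker_combMap_le {s p : Fin 3 → MvPolynomial (Fin 3) K} {m q : Fin 3 → ℕ} {D d : ℕ}
    (hs : IsPrimitiveVec s) (hp : IsPrimitiveVec p)
    (hm : ∀ i, (s i).IsHomogeneous (m i)) (hq : ∀ i, (p i).IsHomogeneous (q i))
    (hD : ∀ i, m i + q i = D) (hsp : p ⬝ᵥ s = 0) (hd2 : m 0 + m 1 + m 2 ≤ d) (hd3 : D ≤ d) :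
    finrank K (LinearMap.ker (combMap s fun i => d - m i)) ≤
      (d - D + 2).choose 2 + (d + D - (m 0 + m 1 + m 2) + 2).choose 2 := by
  set e : Fin 3 → ℕ := fun i => d - m i with he
  have hmd : ∀ i, m i ≤ d := fun i => by fin_cases i <;> simp <;> omega
  set χ := (crossMap p e).domRestrict (LinearMap.ker (combMap s e)) with hχ
  have h4 := LinearMap.finrank_range_add_finrank_ker (V := ↥(LinearMap.ker (combMap s e)))
    (V₂ := Fin 3 → MvPolynomial (Fin 3) K) χ
  have h5 : finrank K (LinearMap.range χ) ≤ (d + D - (m 0 + m 1 + m 2) + 2).choose 2 := by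
    refine (Submodule.finrank_mono ?_).trans (finrank_formMultiples_le s _)
    rintro _ ⟨⟨a, ha⟩, rfl⟩
    rw [LinearMap.mem_ker, combMap_apply] at ha
    rw [hχ, LinearMap.domRestrict_apply, crossMap_apply]
    refine hs.mem_formMultiples hm (fun i => ?_) (mul_cross_comm hsp ha)
    have aux : ∀ i j k : Fin 3, m i + m j + m k = m 0 + m 1 + m 2 →
        (p i * (a j).1 - p j * (a i).1).IsHomogeneous (d + D - (m 0 + m 1 + m 2) + m k) := by
      intro i j k hijk
      have e1 := (hq i).mul (show (a j).1.IsHomogeneous (e j) from (a j).2)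
      have e2 := (hq j).mul (show (a i).1.IsHomogeneous (e i) from (a i).2)
      have hi := hD i
      have hj := hD j
      have hi' := hmd i
      have hj' := hmd j
      rw [show q i + e j = d + D - (m 0 + m 1 + m 2) + m k by simp only [he]; omega] at e1
      rw [show q j + e i = d + D - (m 0 + m 1 + m 2) + m k by simp only [he]; omega] at e2
      exact e1.sub e2
    rw [cross_apply]
    fin_cases i
    · exact aux 1 2 0 (by omega)
    · exact aux 2 0 1 (by omega)
    · exact aux 0 1 2 (by omega)
  have h6 : finrank K (LinearMap.ker χ) ≤ (d - D + 2).choose 2 := by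
    let j : (LinearMap.ker χ) →ₗ[K] (Fin 3 → MvPolynomial (Fin 3) K) :=
      (LinearMap.pi fun i => Submodule.subtype _ ∘ₗ LinearMap.proj i) ∘ₗ
        (Submodule.subtype _) ∘ₗ (Submodule.subtype _)
    have hj : Function.Injective j := fun a b hab =>
      Subtype.ext (Subtype.ext (funext fun i => Subtype.ext (congrFun hab i)))
    rw [← LinearMap.finrank_range_of_inj hj]
    refine (Submodule.finrank_mono ?_).trans (finrank_formMultiples_le p _)
    rintro _ ⟨⟨⟨a, ha⟩, ha'⟩, rfl⟩
    rw [LinearMap.mem_ker, hχ, LinearMap.domRestrict_apply, crossMap_apply] at ha'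
    refine hp.mem_formMultiples hq (fun i => ?_) (mul_comm_of_cross_eq_zero ha')
    have hi := hD i
    rw [show d - D + q i = e i by simp only [he]; omega]
    exact (a i).2
  change finrank K (LinearMap.ker (combMap s e)) ≤ _
  omega

theorem card_zeros_add_le {s p : Fin 3 → MvPolynomial (Fin 3) K} {m q : Fin 3 → ℕ} {D d : ℕ}
    (hs : IsPrimitiveVec s) (hp : IsPrimitiveVec p)
    (hm : ∀ i, (s i).IsHomogeneous (m i)) (hq : ∀ i, (p i).IsHomogeneous (q i))
    (hD : ∀ i, m i + q i = D) (hsp : p ⬝ᵥ s = 0)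
    {ι : Type*} [Fintype ι] {v : ι → Fin 3 → K} (h0 : ∀ i, v i ≠ 0)
    (hv : ∀ i j, i ≠ j → v i ⨯₃ v j ≠ 0) (hz : ∀ i j, eval (v i) (s j) = 0)
    (hd1 : Fintype.card ι ≤ d) (hd2 : m 0 + m 1 + m 2 ≤ d) (hd3 : D ≤ d) :
    Fintype.card ι + ∑ i, (d - m i + 2).choose 2 ≤
      (d + 2).choose 2 + (d - D + 2).choose 2 + (d + D - (m 0 + m 1 + m 2) + 2).choose 2 := by
  have hmd : ∀ i, m i ≤ d := fun i => by fin_cases i <;> simp <;> omega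
  have h2 := finrank_range_combMap_add_le hm hmd h0 hv hz hd1
  have h3 := LinearMap.finrank_range_add_finrank_ker (combMap s fun i => d - m i)
  rw [Module.finrank_pi_fintype] at h3
  simp only [finrank_homogeneousSubmodule] at h3
  have h4 := finrank_ker_combMap_le hs hp hm hq hD hsp hd2 hd3
  omega

end Count

theorem two_mul_choose_two (n : ℕ) : 2 * ((n + 2).choose 2 : ℤ) = (n + 2) * (n + 1) := by
  rw [Nat.choose_two_right]
  have h2 : 2 ∣ (n + 2) * (n + 2 - 1) := (Nat.even_mul_pred_self (n + 2)).two_dvd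
  have h3 := Nat.mul_div_cancel' h2
  simp only [show n + 2 - 1 = n + 1 by omega] at h3 ⊢
  exact_mod_cast h3

theorem card_zeros_le {K : Type*} [Field K] {s p : Fin 3 → MvPolynomial (Fin 3) K}
    {m q : Fin 3 → ℕ} {D : ℕ} (hs : IsPrimitiveVec s) (hp : IsPrimitiveVec p)
    (hm : ∀ i, (s i).IsHomogeneous (m i)) (hq : ∀ i, (p i).IsHomogeneous (q i))
    (hD : ∀ i, m i + q i = D) (hsp : p ⬝ᵥ s = 0)
    {ι : Type*} [Fintype ι] {v : ι → Fin 3 → K} (h0 : ∀ i, v i ≠ 0)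
    (hv : ∀ i j, i ≠ j → v i ⨯₃ v j ≠ 0) (hz : ∀ i j, eval (v i) (s j) = 0) :
    Fintype.card ι + D * (m 0 + m 1 + m 2) ≤ D ^ 2 + m 0 * m 1 + m 0 * m 2 + m 1 * m 2 := by
  set N := Fintype.card ι with hN
  -- Any sufficiently large degree would do: once the binomials are expanded, `d` cancels.
  have key := card_zeros_add_le (d := N + (m 0 + m 1 + m 2) + D) hs hp hm hq hD hsp h0 hv hz
    (by omega) (by omega) (by omega)
  rw [← hN, Fin.sum_univ_three,
    show N + (m 0 + m 1 + m 2) + D - m 0 = N + D + m 1 + m 2 by omega,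
    show N + (m 0 + m 1 + m 2) + D - m 1 = N + D + m 0 + m 2 by omega,
    show N + (m 0 + m 1 + m 2) + D - m 2 = N + D + m 0 + m 1 by omega,
    show N + (m 0 + m 1 + m 2) + D - D = N + m 0 + m 1 + m 2 by omega,
    show N + (m 0 + m 1 + m 2) + D + D - (m 0 + m 1 + m 2) = N + D + D by omega] at key
  have h1 := two_mul_choose_two (N + (m 0 + m 1 + m 2) + D)
  have h2 := two_mul_choose_two (N + D + m 1 + m 2)
  have h3 := two_mul_choose_two (N + D + m 0 + m 2)
  have h4 := two_mul_choose_two (N + D + m 0 + m 1)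
  have h5 := two_mul_choose_two (N + m 0 + m 1 + m 2)
  have h6 := two_mul_choose_two (N + D + D)
  zify at key ⊢
  push_cast at h1 h2 h3 h4 h5 h6
  linarith

/-! ### A common factor yields infinitely many common zeros -/

section Zeros

variable {K : Type*} [Field K]

/-- The restriction of a polynomial to the line `u + λ v`. -/
def lineRestrict {σ : Type*} (u v : σ → K) (f : MvPolynomial σ K) : Polynomial K :=
  aeval (fun i => Polynomial.C (u i) + Polynomial.C (v i) * Polynomial.X) f

theorem eval_lineRestrict {σ : Type*} (u v : σ → K) (f : MvPolynomial σ K) (t : K) :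
    (lineRestrict u v f).eval t = eval (u + t • v) f := by
  induction f using MvPolynomial.induction_on with
  | C a => simp [lineRestrict]
  | add p q hp hq => simpa [lineRestrict] using congrArg₂ (· + ·) hp hq
  | mul_X p i hp =>
    rw [map_mul, ← hp]
    simp only [lineRestrict, map_mul, aeval_X, Polynomial.eval_mul, Polynomial.eval_add,
      Polynomial.eval_C, Polynomial.eval_X, eval_X, Pi.add_apply, Pi.smul_apply, smul_eq_mul]
    ring

theorem eval_smul_of_isHomogeneous {σ : Type*} {f : MvPolynomial σ K} {n : ℕ}
    (hf : f.IsHomogeneous n) (c : K) (x : σ → K) : eval (c • x) f = c ^ n * eval x f := by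
  rw [eval_eq, eval_eq, Finset.mul_sum]
  refine Finset.sum_congr rfl fun d hd => ?_
  have hdeg : ∑ i ∈ d.support, d i = n := by
    simpa [Finsupp.weight_apply, Finsupp.sum] using hf (mem_support_iff.mp hd)
  simp only [Pi.smul_apply, smul_eq_mul, mul_pow, Finset.prod_mul_distrib,
    Finset.prod_pow_eq_pow_sum, hdeg]
  ring

theorem exists_zero_on_line [IsAlgClosed K] {σ : Type*} {f : MvPolynomial σ K} {n : ℕ}
    (hf : f.IsHomogeneous n) (hn : n ≠ 0) (u v : σ → K) :
    (∃ t : K, eval (u + t • v) f = 0) ∨ eval v f = 0 := by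
  by_cases hdeg : (lineRestrict u v f).degree = 0
  · right
    obtain ⟨c, hc⟩ : ∃ c, lineRestrict u v f = Polynomial.C c :=
      ⟨_, Polynomial.eq_C_of_degree_eq_zero hdeg⟩
    have h1 : ∀ t : K, eval (u + t • v) f = c := fun t => by
      rw [← eval_lineRestrict, hc, Polynomial.eval_C]
    -- On a line where `f` has the constant value `c`, homogeneity gives `f (v + t u) = t ^ n f (u +
    -- t⁻¹ v) = c t ^ n` for `t ≠ 0`, hence as polynomials; at `t = 0` this is `f v = 0`.
    have h2 : lineRestrict v u f = Polynomial.C c * Polynomial.X ^ n := by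
      refine Polynomial.eq_of_infinite_eval_eq _ _ (Set.Infinite.mono (s := {0}ᶜ) ?_ ?_)
      · intro t ht
        have ht : t ≠ 0 := ht
        have h3 := eval_smul_of_isHomogeneous hf t (u + t⁻¹ • v)
        rw [h1, smul_add, smul_smul, mul_inv_cancel₀ ht, one_smul, add_comm] at h3
        rw [Set.mem_ofPred_eq, eval_lineRestrict, h3, Polynomial.eval_mul, Polynomial.eval_C,
          Polynomial.eval_pow, Polynomial.eval_X, mul_comm]
      · exact (Set.finite_singleton _).infinite_compl
    have h3 := eval_lineRestrict v u f 0
    rw [h2] at h3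
    simpa [hn] using h3.symm
  · left
    obtain ⟨t, ht⟩ := IsAlgClosed.exists_root _ hdeg
    exact ⟨t, by rw [← eval_lineRestrict]; exact ht⟩

theorem exists_zero_family_of_isHomogeneous [IsAlgClosed K] {g : MvPolynomial (Fin 3) K} {n : ℕ}
    (hg : g.IsHomogeneous n) (hn : n ≠ 0) (hg0 : g ≠ 0) :
    ∃ x : K → Fin 3 → K, (∀ t, eval (x t) g = 0) ∧ ∀ t t', t ≠ t' → x t ⨯₃ x t' ≠ 0 := by
  obtain ⟨q, hq⟩ : ∃ q, eval q g ≠ 0 := by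
    by_contra! h
    exact hg0 (MvPolynomial.funext fun q => by simp [h q])
  obtain ⟨α, β, hd⟩ : ∃ α β : Fin 3 → K, q ⬝ᵥ (α ⨯₃ β) ≠ 0 := by
    have hq0 : q ≠ 0 := by
      rintro rfl
      have := eval_smul_of_isHomogeneous hg 0 0
      rw [zero_smul, zero_pow hn, zero_mul] at this
      exact hq this
    obtain ⟨k, hk⟩ := Function.ne_iff.mp hq0
    fin_cases k
    · exact ⟨Pi.single 1 1, Pi.single 2 1, by simpa [cross_apply, dotProduct, Fin.sum_univ_three] using hk⟩
    · exact ⟨Pi.single 2 1, Pi.single 0 1, by simpa [cross_apply, dotProduct, Fin.sum_univ_three] using hk⟩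
    · exact ⟨Pi.single 0 1, Pi.single 1 1, by simpa [cross_apply, dotProduct, Fin.sum_univ_three] using hk⟩
  -- The lines through a point `q` off the curve each meet the curve, necessarily away from `q`;
  -- distinct lines give distinct points.
  have key : ∀ t : K, ∃ c : K, eval (α + t • β + c • q) g = 0 := fun t =>
    (exists_zero_on_line hg hn (α + t • β) q).resolve_right hq
  choose c hc using key
  refine ⟨_, hc, fun t t' htt h => ?_⟩
  have h1 : q ⬝ᵥ ((α + t • β + c t • q) ⨯₃ (α + t' • β + c t' • q)) =
      (t' - t) * (q ⬝ᵥ (α ⨯₃ β)) := by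
    simp [cross_apply, dotProduct, Fin.sum_univ_three]
    ring
  rw [h, dotProduct_zero] at h1
  exact mul_ne_zero (sub_ne_zero.mpr htt.symm) hd h1.symm

theorem exists_zero_family [IsAlgClosed K] {s : Fin 3 → MvPolynomial (Fin 3) K} {m : Fin 3 → ℕ}
    (hm : ∀ i, (s i).IsHomogeneous (m i)) (hs : ¬ IsPrimitiveVec s) :
    ∃ x : K → Fin 3 → K, (∀ t i, eval (x t) (s i) = 0) ∧ ∀ t t', t ≠ t' → x t ⨯₃ x t' ≠ 0 := by
  obtain ⟨g, n, hg, hn, hg0, hgs⟩ : ∃ (g : MvPolynomial (Fin 3) K) (n : ℕ), g.IsHomogeneous n ∧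
      n ≠ 0 ∧ g ≠ 0 ∧ ∀ i, g ∣ s i := by
    by_cases h0 : ∀ i, s i = 0
    · exact ⟨X 0, 1, isHomogeneous_X K 0, one_ne_zero, X_ne_zero 0, fun i => by simp [h0 i]⟩
    · push Not at h0
      obtain ⟨k, hk⟩ := h0
      unfold IsPrimitiveVec at hs
      push Not at hs
      obtain ⟨d, hd, hu⟩ := hs
      obtain ⟨c, hc⟩ := hd k
      obtain ⟨n, hn⟩ := IsHomogeneous.exists_of_mul (hc ▸ hm k) (hc ▸ hk)
      have hd0 : d ≠ 0 := by
        rintro rfl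
        simp [hc] at hk
      refine ⟨d, n, hn, ?_, hd0, hd⟩
      rintro rfl
      rw [totalDegree_eq_zero_iff_eq_C.mp ((totalDegree_zero_iff_isHomogeneous _).mpr hn)] at hu hd0
      simp at hu hd0
      exact hd0 hu
  obtain ⟨x, hx, hxx⟩ := exists_zero_family_of_isHomogeneous hg hn hg0
  refine ⟨x, fun t i => ?_, hxx⟩
  obtain ⟨c, hc⟩ := hgs i
  rw [hc, map_mul, hx, zero_mul]

end Zeros

/-! ### Linear substitutions and the equations of singular points -/

section Substitution

variable {K : Type*} [Field K] {n : ℕ}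

/-- The polynomial `v ↦ f (M v)`. -/
def matSubst (M : Matrix (Fin n) (Fin n) K) (f : MvPolynomial (Fin n) K) :
    MvPolynomial (Fin n) K :=
  bind₁ M.toMvPolynomial f

theorem eval_matSubst (M : Matrix (Fin n) (Fin n) K) (f : MvPolynomial (Fin n) K)
    (v : Fin n → K) : eval v (matSubst M f) = eval (M *ᵥ v) f := by
  rw [matSubst, ← coe_aeval_eq_eval, RingHom.coe_coe, aeval_bind₁, ← coe_aeval_eq_eval,
    RingHom.coe_coe]
  congr 2
  ext i
  rw [aeval_eq_eval, M.toMvPolynomial_eval_eq_apply]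

theorem pderiv_toMvPolynomial (M : Matrix (Fin n) (Fin n) K) (i j : Fin n) :
    pderiv i (M.toMvPolynomial j) = C (M j i) := by
  classical
  rw [Matrix.toMvPolynomial, map_sum]
  simp_rw [← C_mul_X_eq_monomial, pderiv_C_mul, pderiv_X]
  simp [Pi.single_apply]

theorem pderiv_matSubst (M : Matrix (Fin n) (Fin n) K) (f : MvPolynomial (Fin n) K) (i : Fin n) :
    pderiv i (matSubst M f) = ∑ j, C (M j i) * matSubst M (pderiv j f) := by
  classical
  unfold matSubst
  induction f using MvPolynomial.induction_on with
  | C a => simp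
  | add p q hp hq => simp [hp, hq, mul_add, Finset.sum_add_distrib]
  | mul_X p k hp =>
    simp only [map_mul, bind₁_X_right, pderiv_mul, hp, pderiv_toMvPolynomial, map_add, pderiv_X,
      mul_add, Finset.sum_add_distrib, Finset.sum_mul]
    congr 1
    · exact Finset.sum_congr rfl fun j _ => by ring
    · rw [Finset.sum_eq_single k]
      · simp [mul_comm]
      · intro j _ hj
        simp [hj.symm]
      · simp

theorem isHomogeneous_matSubst (M : Matrix (Fin n) (Fin n) K) {f : MvPolynomial (Fin n) K} {d : ℕ}
    (hf : f.IsHomogeneous d) : (matSubst M f).IsHomogeneous d := by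
  simpa [matSubst] using hf.aeval M.toMvPolynomial fun i => M.toMvPolynomial_isHomogeneous i

/-- All partial derivatives of `f` and `f` itself vanish at `v`. -/
def IsSing (f : MvPolynomial (Fin n) K) (v : Fin n → K) : Prop :=
  eval v f = 0 ∧ ∀ i, eval v (pderiv i f) = 0

theorem isSing_matSubst_iff {M : Matrix (Fin n) (Fin n) K} (hM : IsUnit M.det)
    (f : MvPolynomial (Fin n) K) (v : Fin n → K) : IsSing (matSubst M f) v ↔ IsSing f (M *ᵥ v) := by
  unfold IsSing
  rw [eval_matSubst]
  refine and_congr_right fun _ => ?_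
  have h : (fun i => eval v (pderiv i (matSubst M f))) =
      Mᵀ *ᵥ fun j => eval (M *ᵥ v) (pderiv j f) := by
    ext i
    rw [pderiv_matSubst, map_sum]
    simp [eval_matSubst, mulVec, dotProduct]
  have hinj : Function.Injective (Mᵀ).mulVec :=
    mulVec_injective_of_isUnit ((isUnit_iff_isUnit_det _).mpr (by rwa [det_transpose]))
  have h2 : (∀ i, eval v (pderiv i (matSubst M f)) = 0) ↔
      (fun i => eval v (pderiv i (matSubst M f))) = 0 := funext_iff.symm
  have h3 : (∀ i, eval (M *ᵥ v) (pderiv i f) = 0) ↔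
      (fun i => eval (M *ᵥ v) (pderiv i f)) = 0 := funext_iff.symm
  rw [h2, h3, h]
  constructor
  · intro h0
    exact hinj (by rw [h0, mulVec_zero])
  · intro h0
    rw [h0, mulVec_zero]

theorem isSing_smul_iff {f : MvPolynomial (Fin n) K} {d : ℕ} (hf : f.IsHomogeneous d) {c : K}
    (hc : c ≠ 0) (v : Fin n → K) : IsSing f (c • v) ↔ IsSing f v := by
  unfold IsSing
  simp only [eval_smul_of_isHomogeneous hf, fun i => eval_smul_of_isHomogeneous (hf.pderiv (i := i)),
    mul_eq_zero, pow_eq_zero_iff', hc, false_and, false_or]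

theorem mk_mem_singLocus_iff {F : MvPolynomial (Fin 4) K} {d : ℕ} (hF : F.IsHomogeneous d)
    (v : Fin 4 → K) (hv : v ≠ 0) :
    Projectivization.mk K v hv ∈ singLocus F ↔ IsSing F v := by
  obtain ⟨a, ha⟩ := Projectivization.exists_smul_eq_mk_rep K v hv
  change IsSing F (Projectivization.mk K v hv).rep ↔ _
  rw [← ha]
  exact isSing_smul_iff hF a.ne_zero v

theorem encard_singLocus_matSubst {F : MvPolynomial (Fin 4) K} {d : ℕ} (hF : F.IsHomogeneous d)
    {M : Matrix (Fin 4) (Fin 4) K} (hM : IsUnit M.det) :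
    (singLocus (matSubst M F)).encard = (singLocus F).encard := by
  have hinj : Function.Injective (Matrix.mulVecLin M) :=
    mulVec_injective_of_isUnit ((isUnit_iff_isUnit_det _).mpr hM)
  rw [← (Projectivization.map_injective _ hinj).encard_image]
  congr 1
  ext p
  constructor
  · rintro ⟨r, hr, rfl⟩
    induction r using Projectivization.ind with
    | h v hv =>
      rw [mk_mem_singLocus_iff (isHomogeneous_matSubst M hF), isSing_matSubst_iff hM] at hr
      rw [Projectivization.map_mk, mk_mem_singLocus_iff hF]
      exact hr
  · intro hp
    induction p using Projectivization.ind with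
    | h v hv =>
      rw [mk_mem_singLocus_iff hF] at hp
      have h1 : M *ᵥ (M⁻¹ *ᵥ v) = v := by
        rw [mulVec_mulVec, mul_nonsing_inv _ hM, one_mulVec]
      have h2 : M⁻¹ *ᵥ v ≠ 0 := fun h => hv (by rw [← h1, h, mulVec_zero])
      refine ⟨Projectivization.mk K _ h2, ?_, ?_⟩
      · rwa [mk_mem_singLocus_iff (isHomogeneous_matSubst M hF), isSing_matSubst_iff hM, h1]
      · rw [Projectivization.map_mk]
        simp [h1]

/-- The linear map `(x, z) ↦ (M x, z)`. -/
def blockMatrix (M : Matrix (Fin 3) (Fin 3) K) : Matrix (Fin 4) (Fin 4) K :=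
  reindex finSumFinEquiv finSumFinEquiv (fromBlocks M 0 0 (1 : Matrix (Fin 1) (Fin 1) K))

theorem det_blockMatrix (M : Matrix (Fin 3) (Fin 3) K) : (blockMatrix M).det = M.det := by
  rw [blockMatrix, det_reindex_self, det_fromBlocks_zero₂₁, det_one, mul_one]

theorem toMvPolynomial_blockMatrix_castSucc (M : Matrix (Fin 3) (Fin 3) K) (i : Fin 3) :
    (blockMatrix M).toMvPolynomial i.castSucc = rename Fin.castSucc (M.toMvPolynomial i) := by
  simp only [Matrix.toMvPolynomial, ← C_mul_X_eq_monomial, map_sum, map_mul, rename_C, rename_X]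
  rw [Fin.sum_univ_castSucc]
  have h1 : ∀ j : Fin 3, blockMatrix M i.castSucc j.castSucc = M i j := fun j => by
    fin_cases i <;> fin_cases j <;> rfl
  have h2 : blockMatrix M i.castSucc 3 = 0 := by
    fin_cases i <;> rfl
  simp [h1, h2]

theorem toMvPolynomial_blockMatrix_last (M : Matrix (Fin 3) (Fin 3) K) :
    (blockMatrix M).toMvPolynomial 3 = X 3 := by
  simp only [Matrix.toMvPolynomial, ← C_mul_X_eq_monomial]
  rw [Fin.sum_univ_castSucc]
  have h1 : ∀ j : Fin 3, blockMatrix M 3 j.castSucc = 0 := fun j => by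
    fin_cases j <;> rfl
  have h2 : blockMatrix M 3 (Fin.last 3) = 1 := rfl
  rw [h2]
  simp [h1]

theorem matSubst_blockMatrix_lift4 (M : Matrix (Fin 3) (Fin 3) K) (f : MvPolynomial (Fin 3) K) :
    matSubst (blockMatrix M) (lift4 f) = lift4 (matSubst M f) := by
  unfold matSubst lift4
  rw [bind₁_rename]
  simp only [Function.comp_def, toMvPolynomial_blockMatrix_castSucc]
  rw [rename_bind₁]

theorem matSubst_blockMatrix_taylorForm (M : Matrix (Fin 3) (Fin 3) K)
    (Q G B : MvPolynomial (Fin 3) K) :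
    matSubst (blockMatrix M) (taylorForm Q G B) =
      taylorForm (matSubst M Q) (matSubst M G) (matSubst M B) := by
  have hX : matSubst (blockMatrix M) (X 3) = X 3 := by
    rw [matSubst, bind₁_X_right, toMvPolynomial_blockMatrix_last]
  have hmul : ∀ f g : MvPolynomial (Fin 4) K, matSubst (blockMatrix M) (f * g) =
    matSubst (blockMatrix M) f * matSubst (blockMatrix M) g := map_mul (bind₁ _)
  have hadd : ∀ f g : MvPolynomial (Fin 4) K, matSubst (blockMatrix M) (f + g) =
    matSubst (blockMatrix M) f + matSubst (blockMatrix M) g := map_add (bind₁ _)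
  simp only [taylorForm, pow_two, hmul, hadd, hX, matSubst_blockMatrix_lift4]

theorem isHomogeneous_taylorForm {Q G B : MvPolynomial (Fin 3) K} (hQ : Q.IsHomogeneous 2)
    (hG : G.IsHomogeneous 3) (hB : B.IsHomogeneous 4) : (taylorForm Q G B).IsHomogeneous 4 :=
  ((((isHomogeneous_X K 3).pow 2).mul hQ.rename_isHomogeneous).add
    ((isHomogeneous_X K 3).mul hG.rename_isHomogeneous)).add hB.rename_isHomogeneous

/-- The affine equations of the singular points of `z² Q(x) + B(x) = 0` in characteristic 2. -/
def IsSingAt (Q B : MvPolynomial (Fin 3) K) (x : Fin 3 → K) (z : K) : Prop :=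
  z ^ 2 * eval x Q + eval x B = 0 ∧ ∀ i, z ^ 2 * eval x (pderiv i Q) + eval x (pderiv i B) = 0

theorem isSing_taylorForm_iff [CharP K 2] (Q B : MvPolynomial (Fin 3) K) (x : Fin 3 → K) (z : K) :
    IsSing (taylorForm Q 0 B) (Fin.snoc x z) ↔ IsSingAt Q B x z := by
  have he : ∀ f : MvPolynomial (Fin 3) K,
      eval (Fin.snoc x z : Fin 4 → K) (rename Fin.castSucc f) = eval x f := fun f => by
    rw [eval_rename]
    congr 2
    ext i
    simp
  have hz : (Fin.snoc x z : Fin 4 → K) 3 = z := Fin.snoc_last (α := fun _ : Fin 4 => K) z x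
  have h3 : ∀ f : MvPolynomial (Fin 3) K, pderiv 3 (rename Fin.castSucc f) = 0 := fun f => by
    refine pderiv_eq_zero_of_notMem_vars fun h => ?_
    obtain ⟨j, -, hj⟩ := Finset.mem_image.mp (vars_rename _ _ h)
    exact (Fin.castSucc_lt_last j).ne hj
  have hX : ∀ i : Fin 3, pderiv i.castSucc (X 3 : MvPolynomial (Fin 4) K) = 0 := fun i =>
    pderiv_X_of_ne (Fin.castSucc_lt_last i).ne'
  have e0 : eval (Fin.snoc x z : Fin 4 → K) (taylorForm Q 0 B) = z ^ 2 * eval x Q + eval x B := by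
    simp [taylorForm, lift4, he, hz]
  have e1 : ∀ i : Fin 3, eval (Fin.snoc x z : Fin 4 → K) (pderiv i.castSucc (taylorForm Q 0 B)) =
      z ^ 2 * eval x (pderiv i Q) + eval x (pderiv i B) := fun i => by
    simp [taylorForm, lift4, hX, pderiv_rename (Fin.castSucc_injective 3), he, hz]
  have e2 : eval (Fin.snoc x z : Fin 4 → K) (pderiv 3 (taylorForm Q 0 B)) = 0 := by
    simp [taylorForm, lift4, h3, CharTwo.two_eq_zero]
  unfold IsSing IsSingAt
  rw [e0]
  refine and_congr_right fun _ => ⟨fun h i => ?_, fun h i => ?_⟩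
  · rw [← e1, h]
  · induction i using Fin.lastCases with
    | last => exact e2
    | cast i => rw [e1, h]

end Substitution

theorem snoc_init {α : Type*} (v : Fin 4 → α) :
    (Fin.snoc (fun i => v i.castSucc) (v 3) : Fin 4 → α) = v :=
  Fin.snoc_init_self (α := fun _ : Fin 4 => α) v

/-! ### From singular points of the surface to zeros in the plane -/

section Bound

variable {K : Type*} [Field K]

theorem snoc_three {α : Type*} (x : Fin 3 → α) (z : α) : (Fin.snoc x z : Fin 4 → α) 3 = z :=
  Fin.snoc_last (α := fun _ : Fin 4 => α) z x

theorem smul_snoc (c : K) (x : Fin 3 → K) (z : K) :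
    c • (Fin.snoc x z : Fin 4 → K) = Fin.snoc (c • x) (c * z) := by
  ext i
  induction i using Fin.lastCases <;> simp [snoc_three]

theorem snoc_ne_zero {x : Fin 3 → K} (hx : x ≠ 0) (z : K) : (Fin.snoc x z : Fin 4 → K) ≠ 0 := by
  intro h
  refine hx (funext fun i => ?_)
  have := congrFun h i.castSucc
  simpa using this

theorem exists_smul_of_cross_eq_zero {x y : Fin 3 → K} (hx : x ≠ 0) (hy : y ≠ 0)
    (h : x ⨯₃ y = 0) : ∃ c : K, c ≠ 0 ∧ x = c • y := by
  obtain ⟨k, hk⟩ := Function.ne_iff.mp hy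
  simp only [Pi.zero_apply] at hk
  have h1 : x = (x k / y k) • y := by
    ext j
    have := mul_comm_of_cross_eq_zero h j k
    rw [Pi.smul_apply, smul_eq_mul, div_mul_eq_mul_div, eq_div_iff hk, this, mul_comm]
  refine ⟨x k / y k, fun h0 => hx ?_, h1⟩
  rw [h1, h0, zero_smul]

variable [CharP K 2] {Q B : MvPolynomial (Fin 3) K}

theorem mk_snoc_mem_singLocus_iff (hQ : Q.IsHomogeneous 2) (hB : B.IsHomogeneous 4)
    {x : Fin 3 → K} {z : K} (h : (Fin.snoc x z : Fin 4 → K) ≠ 0) :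
    Projectivization.mk K _ h ∈ singLocus (taylorForm Q 0 B) ↔ IsSingAt Q B x z := by
  rw [mk_mem_singLocus_iff (isHomogeneous_taylorForm hQ (isHomogeneous_zero ..) hB),
    isSing_taylorForm_iff]

theorem IsSingAt.smul (hQ : Q.IsHomogeneous 2) (hB : B.IsHomogeneous 4) {x : Fin 3 → K} {z c : K}
    (hc : c ≠ 0) (h : IsSingAt Q B x z) : IsSingAt Q B (c • x) (c * z) := by
  rw [← isSing_taylorForm_iff] at h ⊢
  rw [← smul_snoc]
  exact (isSing_smul_iff (isHomogeneous_taylorForm hQ (isHomogeneous_zero ..) hB) hc _).mpr h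

theorem infinite_singLocus_of_family [Infinite K] (hQ : Q.IsHomogeneous 2) (hB : B.IsHomogeneous 4)
    {x : K → Fin 3 → K} (hx : ∀ t t', t ≠ t' → x t ⨯₃ x t' ≠ 0) {S : Set K} (hS : S.Infinite)
    (h : ∀ t ∈ S, ∃ z, IsSingAt Q B (x t) z) : (singLocus (taylorForm Q 0 B)).Infinite := by
  have hx0 : ∀ t, x t ≠ 0 := fun t h0 => by
    refine hx t (t + 1) (by simp) ?_
    rw [h0]
    simp
  have hSi : Infinite S := hS.to_subtype
  choose z hz using h
  refine Set.infinite_of_injective_forall_mem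
    (f := fun t : S => Projectivization.mk K _ (snoc_ne_zero (hx0 t) (z t t.2))) ?_ fun t =>
      (mk_snoc_mem_singLocus_iff hQ hB _).mpr (hz t t.2)
  intro t t' htt
  obtain ⟨a, ha⟩ := (Projectivization.mk_eq_mk_iff' _ _ _ _ _).mp htt
  rw [smul_snoc] at ha
  have h1 : a • x t' = x t := by
    ext i
    simpa using congrFun ha i.castSucc
  by_contra hne
  refine hx t t' (fun h => hne (Subtype.ext h)) ?_
  rw [← h1]
  simp

/-- Squaring is injective in characteristic 2, so two values of `z` give two values of `z²` in
equations linear in `z²`. Then `Q`, `B` and their derivatives all vanish at `x`, and every point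
over `x` is singular. -/
theorem IsSingAt.unique [Infinite K] (hQ : Q.IsHomogeneous 2) (hB : B.IsHomogeneous 4)
    (hfin : (singLocus (taylorForm Q 0 B)).Finite) {x : Fin 3 → K} (hx : x ≠ 0) {z z' : K}
    (h : IsSingAt Q B x z) (h' : IsSingAt Q B x z') : z = z' := by
  by_contra hne
  have hsq : z ^ 2 - z' ^ 2 ≠ 0 := by
    rw [← sub_pow_char z z']
    exact pow_ne_zero 2 (sub_ne_zero.mpr hne)
  have aux : ∀ a b : K, z ^ 2 * a + b = 0 → z' ^ 2 * a + b = 0 → a = 0 ∧ b = 0 := by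
    intro a b h1 h2
    have ha : a = 0 := by
      refine (mul_eq_zero.mp ?_).resolve_left hsq
      linear_combination h1 - h2
    subst ha
    exact ⟨rfl, by simpa using h1⟩
  obtain ⟨q0, b0⟩ := aux _ _ h.1 h'.1
  have hall : ∀ w, IsSingAt Q B x w := fun w => by
    refine ⟨by rw [q0, b0]; simp, fun i => ?_⟩
    obtain ⟨qi, bi⟩ := aux _ _ (h.2 i) (h'.2 i)
    rw [qi, bi]
    simp
  refine Set.infinite_of_injective_forall_mem
    (f := fun w : K => Projectivization.mk K _ (snoc_ne_zero hx w)) ?_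
    (fun w => (mk_snoc_mem_singLocus_iff hQ hB _).mpr (hall w)) hfin
  intro w w' hw
  obtain ⟨a, ha⟩ := (Projectivization.mk_eq_mk_iff' _ _ _ _ _).mp hw
  rw [smul_snoc] at ha
  obtain ⟨k, hk⟩ := Function.ne_iff.mp hx
  have h1 : a * x k = x k := by simpa using congrFun ha k.castSucc
  have h2 : a = 1 := by
    have : (a - 1) * x k = 0 := by linear_combination h1
    exact sub_eq_zero.mp ((mul_eq_zero.mp this).resolve_right hk)
  have h3 := congrFun ha (Fin.last 3)
  simpa [h2, snoc_three] using h3.symm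

/-- `N` bounds the zeros of `s`, hence the singular points other than the vertex, whose projections
are pairwise non-proportional; the `+ 1` allows for the vertex. -/
theorem encard_singLocus_le [Infinite K] (hQ : Q.IsHomogeneous 2) (hB : B.IsHomogeneous 4)
    (hfin : (singLocus (taylorForm Q 0 B)).Finite) {s p : Fin 3 → MvPolynomial (Fin 3) K}
    {m q : Fin 3 → ℕ} {D N : ℕ} (hs : IsPrimitiveVec s) (hp : IsPrimitiveVec p)
    (hm : ∀ i, (s i).IsHomogeneous (m i)) (hq : ∀ i, (p i).IsHomogeneous (q i))
    (hD : ∀ i, m i + q i = D) (hsp : p ⬝ᵥ s = 0)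
    (hsing : ∀ x z, IsSingAt Q B x z → ∀ i, eval x (s i) = 0)
    (hN : D ^ 2 + m 0 * m 1 + m 0 * m 2 + m 1 * m 2 ≤ N + D * (m 0 + m 1 + m 2)) :
    (singLocus (taylorForm Q 0 B)).encard ≤ (N + 1 : ℕ) := by
  set T := singLocus (taylorForm Q 0 B) \ {vertex K} with hT
  have hTfin : T.Finite := hfin.subset Set.sdiff_subset
  have : Fintype T := hTfin.fintype
  let v : T → Fin 3 → K := fun r i => r.1.rep i.castSucc
  have hrep : ∀ r : T, (Fin.snoc (v r) (r.1.rep 3) : Fin 4 → K) = r.1.rep := fun r =>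
    snoc_init _
  have hSing : ∀ r : T, IsSingAt Q B (v r) (r.1.rep 3) := fun r => by
    rw [← isSing_taylorForm_iff, hrep]
    exact r.2.1
  have hv0 : ∀ r : T, v r ≠ 0 := fun r h0 => by
    refine r.2.2 ?_
    rw [Set.mem_singleton_iff, ← r.1.mk_rep, vertex, Projectivization.mk_eq_mk_iff']
    refine ⟨r.1.rep 3, ?_⟩
    ext i
    induction i using Fin.lastCases with
    | last => simp
    | cast i =>
      have h1 : r.1.rep i.castSucc = 0 := congrFun h0 i
      have h2 : (i.castSucc : Fin 4) ≠ 3 := (Fin.castSucc_lt_last i).ne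
      simp [h1, h2]
  have hcross : ∀ r r' : T, r ≠ r' → v r ⨯₃ v r' ≠ 0 := fun r r' hne h => by
    obtain ⟨c, hc, hcv⟩ := exists_smul_of_cross_eq_zero (hv0 r) (hv0 r') h
    have h1 := IsSingAt.smul hQ hB hc (hSing r')
    rw [← hcv] at h1
    have h2 := IsSingAt.unique hQ hB hfin (hv0 r) (hSing r) h1
    refine hne (Subtype.ext ?_)
    rw [← r.1.mk_rep, ← r'.1.mk_rep, Projectivization.mk_eq_mk_iff']
    exact ⟨c, by rw [← hrep r, ← hrep r', smul_snoc, ← hcv, ← h2]⟩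
  have hcard := card_zeros_le hs hp hm hq hD hsp hv0 hcross
    (fun r j => hsing _ _ (hSing r) j)
  calc (singLocus (taylorForm Q 0 B)).encard ≤ T.encard + ({vertex K} : Set _).encard :=
        Set.encard_le_encard_sdiff_add_encard _ _
    _ = ((Fintype.card T + 1 : ℕ) : ℕ∞) := by
        rw [Set.encard_singleton, ← Set.coe_fintypeCard]
        rfl
    _ ≤ _ := by
        exact_mod_cast (by omega : Fintype.card T + 1 ≤ N + 1)

end Bound

/-! ### The bounds for the three types of conic -/

section Cases

variable {K : Type*} [Field K]

theorem exists_eq_sum_of_isHomogeneous_one {l : MvPolynomial (Fin 3) K}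
    (hl : l.IsHomogeneous 1) : ∃ c : Fin 3 → K, l = ∑ k, C (c k) * X k := by
  have h : l ∈ homogeneousSubmodule (Fin 3) K 1 := hl
  rw [homogeneousSubmodule_one_eq_span_X, Submodule.mem_span_range_iff_exists_fun] at h
  obtain ⟨c, rfl⟩ := h
  exact ⟨c, by simp only [smul_eq_C_mul]⟩

theorem exists_eq_of_isHomogeneous_two {Q : MvPolynomial (Fin 3) K} (hQ : Q.IsHomogeneous 2) :
    ∃ a b c d e f : K, Q = C a * X 0 ^ 2 + C b * X 1 ^ 2 + C c * X 2 ^ 2 + C d * (X 0 * X 1) +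
      C e * (X 0 * X 2) + C f * (X 1 * X 2) := by
  have h : Q ∈ homogeneousSubmodule (Fin 3) K 2 := hQ
  rw [← homogeneousSubmodule_one_pow, homogeneousSubmodule_one_eq_span_X, pow_two,
    Submodule.span_mul_span] at h
  clear hQ
  induction h using Submodule.span_induction with
  | zero => exact ⟨0, 0, 0, 0, 0, 0, by simp⟩
  | add p q _ _ hp hq =>
    obtain ⟨a, b, c, d, e, f, rfl⟩ := hp
    obtain ⟨a', b', c', d', e', f', rfl⟩ := hq
    exact ⟨a + a', b + b', c + c', d + d', e + e', f + f', by simp only [map_add]; ring⟩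
  | smul t p _ hp =>
    obtain ⟨a, b, c, d, e, f, rfl⟩ := hp
    exact ⟨t * a, t * b, t * c, t * d, t * e, t * f, by
      simp only [map_mul, smul_eq_C_mul]; ring⟩
  | mem p hp =>
    obtain ⟨_, ⟨i, rfl⟩, _, ⟨j, rfl⟩, rfl⟩ := hp
    refine ⟨if i = 0 ∧ j = 0 then 1 else 0, if i = 1 ∧ j = 1 then 1 else 0,
      if i = 2 ∧ j = 2 then 1 else 0, if i = 0 ∧ j = 1 ∨ i = 1 ∧ j = 0 then 1 else 0,
      if i = 0 ∧ j = 2 ∨ i = 2 ∧ j = 0 then 1 else 0,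
      if i = 1 ∧ j = 2 ∨ i = 2 ∧ j = 1 then 1 else 0, ?_⟩
    fin_cases i <;> fin_cases j <;> simp <;> ring

theorem irreducible_of_isHomogeneous_one {l : MvPolynomial (Fin 3) K} (hl : l.IsHomogeneous 1)
    (hl0 : l ≠ 0) : Irreducible l := by
  refine irreducible_of_totalDegree_eq_one (hl.totalDegree hl0) fun x hx => ?_
  rw [isUnit_iff_ne_zero]
  rintro rfl
  exact hl0 (MvPolynomial.ext _ _ fun d => by simpa using hx d)

theorem isUnit_of_dvd_X_of_dvd_X {d : MvPolynomial (Fin 3) K} {i j : Fin 3} (hij : i ≠ j)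
    (hi : d ∣ X i) (hj : d ∣ X j) : IsUnit d := by
  have hirr : Irreducible (X i : MvPolynomial (Fin 3) K) := irreducible_of_isHomogeneous_one (isHomogeneous_X K i) (X_ne_zero i)
  refine (hirr.dvd_iff.mp hi).resolve_right fun h => hij ?_
  exact X_dvd_X.mp (h.dvd.trans hj)

/-- Vectors with both coordinates zero are proportional, so at most one `t` is lost. -/
theorem infinite_setOf_ne_zero [Infinite K] {x : K → Fin 3 → K}
    (hx : ∀ t t', t ≠ t' → x t ⨯₃ x t' ≠ 0) : {t | x t 0 ≠ 0 ∨ x t 1 ≠ 0}.Infinite := by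
  have : {t | x t 0 ≠ 0 ∨ x t 1 ≠ 0}ᶜ.Subsingleton := by
    intro t ht t' ht'
    simp only [Set.mem_compl_iff, Set.mem_ofPred_eq, not_or, not_not] at ht ht'
    by_contra hne
    refine hx t t' hne ?_
    rw [cross_apply]
    simp [ht, ht']
  exact compl_compl {t | x t 0 ≠ 0 ∨ x t 1 ≠ 0} ▸ this.finite.infinite_compl

theorem sum_X_mul_pderiv_eq_zero [CharP K 2] {B : MvPolynomial (Fin 3) K}
    (hB : B.IsHomogeneous 4) :
    X 0 * pderiv 0 B + X 1 * pderiv 1 B + X 2 * pderiv 2 B = 0 := by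
  have h := hB.sum_X_mul_pderiv
  rw [Fin.sum_univ_three] at h
  rw [h, nsmul_eq_mul]
  have : ((4 : ℕ) : MvPolynomial (Fin 3) K) = 0 :=
    (CharP.cast_eq_zero_iff _ 2 4).mpr (by norm_num)
  rw [this, zero_mul]

theorem exists_isSingAt [IsAlgClosed K] {Q B : MvPolynomial (Fin 3) K} {x : Fin 3 → K} (w : K)
    (h : w * eval x Q + eval x B = 0)
    (h' : ∀ i, w * eval x (pderiv i Q) + eval x (pderiv i B) = 0) : ∃ z, IsSingAt Q B x z := by
  obtain ⟨z, hz⟩ := IsAlgClosed.exists_pow_nat_eq w (n := 2) (by norm_num)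
  exact ⟨z, by rw [hz]; exact h, fun i => by rw [hz]; exact h' i⟩

/-- Bézout for a line and a cubic: without a common factor they share at most three points. -/
theorem dvd_of_family [CharP K 2] {l f : MvPolynomial (Fin 3) K} (hl : l.IsHomogeneous 1)
    (hl0 : l ≠ 0) (hf : f.IsHomogeneous 3) {x : K → Fin 3 → K}
    (hx : ∀ t t', t ≠ t' → x t ⨯₃ x t' ≠ 0) (hx0 : ∀ t, x t ≠ 0) {S : Set K} (hS : S.Infinite)
    (hxl : ∀ t ∈ S, eval (x t) l = 0) (hxf : ∀ t, eval (x t) f = 0) : l ∣ f := by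
  by_contra hdvd
  have hirr := irreducible_of_isHomogeneous_one hl hl0
  have hprim : ∀ a, a ∣ l → a ∣ f → IsUnit a := fun a h1 h2 =>
    (hirr.dvd_iff.mp h1).resolve_right fun h => hdvd (h.dvd.trans h2)
  obtain ⟨T, hTS, hT⟩ := hS.exists_subset_card_eq 4
  -- The trivial syzygy `f l + l f = 0` of characteristic 2 is padded by zeros, to which the degrees
  -- 4 and 0 are assigned so that all sums are `D = 4`. The bound becomes `1 * 3`, against four
  -- points.
  have := card_zeros_le (s := ![l, f, 0]) (p := ![f, l, 0]) (m := ![1, 3, 4]) (q := ![3, 1, 0])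
    (D := 4) (fun a ha => hprim a (ha 0) (ha 1)) (fun a ha => hprim a (ha 1) (ha 0))
    (fun i => by fin_cases i; exacts [hl, hf, isHomogeneous_zero ..])
    (fun i => by fin_cases i; exacts [hf, hl, isHomogeneous_zero ..])
    (fun i => by fin_cases i <;> rfl)
    (by
      simp only [dotProduct, Fin.sum_univ_three]
      simp only [cons_val_zero, cons_val_one, cons_val]
      linear_combination CharTwo.add_self_eq_zero (l * f))
    (v := fun t : T => x t) (fun t => hx0 t) (fun t t' h => hx t t' fun h' => h (Subtype.ext h'))
    (fun t j => by fin_cases j; exacts [hxl t (hTS t.2), hxf t, map_zero _])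
  simp [hT] at this

variable [IsAlgClosed K] [CharP K 2] {Q B : MvPolynomial (Fin 3) K}

/-- Eliminating `w = z²` between `w Q + B` and the first two derivatives gives `s`. Conversely, away
from the nucleus `x₀ = x₁ = 0`, a zero of `s` lifts to a singular point: `w` is `B / Q`, or where `Q
= 0` it is read off from a derivative of `Q` that does not vanish. -/
theorem encard_le_of_nucleus (hQ : Q.IsHomogeneous 2) (hB : B.IsHomogeneous 4)
    (hfin : (singLocus (taylorForm Q 0 B)).Finite) {d : K} (hd : d ≠ 0)
    (h0 : pderiv 0 Q = C d * X 1) (h1 : pderiv 1 Q = C d * X 0) (h2 : pderiv 2 Q = 0) :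
    (singLocus (taylorForm Q 0 B)).encard ≤ 14 := by
  have hinf : Infinite K := IsAlgClosed.instInfinite
  have hE := sum_X_mul_pderiv_eq_zero hB
  let s : Fin 3 → MvPolynomial (Fin 3) K :=
    ![Q * pderiv 0 B + C d * X 1 * B, Q * pderiv 1 B + C d * X 0 * B, pderiv 2 B]
  have hm : ∀ i, (s i).IsHomogeneous (![5, 5, 3] i) := fun i => by
    have e : ∀ j : Fin 3, (C d * X j * B : MvPolynomial (Fin 3) K).IsHomogeneous 5 := fun j =>
      (isHomogeneous_C_mul_X d j).mul hB
    fin_cases i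
    · exact (hQ.mul hB.pderiv).add (e 1)
    · exact (hQ.mul hB.pderiv).add (e 0)
    · exact hB.pderiv
  have hs : IsPrimitiveVec s := by
    by_contra hs
    obtain ⟨x, hx, hxx⟩ := exists_zero_family hm hs
    refine infinite_singLocus_of_family hQ hB hxx (infinite_setOf_ne_zero hxx) ?_ hfin
    intro t ht
    have e0 : eval (x t) Q * eval (x t) (pderiv 0 B) + d * x t 1 * eval (x t) B = 0 := by
      simpa [s] using hx t 0
    have e1 : eval (x t) Q * eval (x t) (pderiv 1 B) + d * x t 0 * eval (x t) B = 0 := by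
      simpa [s] using hx t 1
    have e2 : eval (x t) (pderiv 2 B) = 0 := by simpa [s] using hx t 2
    have e3 := congrArg (eval (x t)) hE
    simp only [map_add, map_mul, eval_X, map_zero, e2, mul_zero, add_zero] at e3
    have hc : ∀ a : K, a + a = 0 := CharTwo.add_self_eq_zero
    have hsing : ∀ w : K, w * eval (x t) Q + eval (x t) B = 0 →
        w * (d * x t 1) + eval (x t) (pderiv 0 B) = 0 →
        w * (d * x t 0) + eval (x t) (pderiv 1 B) = 0 → ∃ z, IsSingAt Q B (x t) z := by
      intro w a0 a1 a2
      refine exists_isSingAt w a0 fun i => ?_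
      fin_cases i
      · simpa [h0] using a1
      · simpa [h1] using a2
      · simpa [h2] using e2
    by_cases hq : eval (x t) Q = 0
    · have hb : eval (x t) B = 0 := by
        rw [hq, zero_mul, zero_add] at e0 e1
        rcases ht with ht | ht
        · exact (mul_eq_zero.mp e1).resolve_left (mul_ne_zero hd ht)
        · exact (mul_eq_zero.mp e0).resolve_left (mul_ne_zero hd ht)
      by_cases hx1 : x t 1 = 0
      · have hx0 : x t 0 ≠ 0 := ht.resolve_right (not_not.mpr hx1)
        refine hsing (eval (x t) (pderiv 1 B) / (d * x t 0)) (by rw [hq, hb]; ring) ?_ ?_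
        · rw [hx1, zero_mul, add_zero] at e3
          rw [hx1, (mul_eq_zero.mp e3).resolve_left hx0]
          ring
        · rw [div_mul_cancel₀ _ (mul_ne_zero hd hx0), hc]
      · refine hsing (eval (x t) (pderiv 0 B) / (d * x t 1)) (by rw [hq, hb]; ring) ?_ ?_
        · rw [div_mul_cancel₀ _ (mul_ne_zero hd hx1), hc]
        · field_simp
          linear_combination e3
    · refine hsing (eval (x t) B / eval (x t) Q) ?_ ?_ ?_
      · rw [div_mul_cancel₀ _ hq, hc]
      · field_simp
        linear_combination e0
      · field_simp
        linear_combination e1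
  -- `36 + (25 + 15 + 15) - 6 * 13 = 13`.
  refine encard_singLocus_le (N := 13) (p := ![X 0, X 1, X 2 * Q]) (q := ![1, 1, 3]) (D := 6) hQ hB
    hfin hs (fun a ha => isUnit_of_dvd_X_of_dvd_X zero_ne_one (ha 0) (ha 1)) hm ?_ ?_ ?_ ?_ ?_
  · intro i
    fin_cases i
    · exact isHomogeneous_X K 0
    · exact isHomogeneous_X K 1
    · exact (isHomogeneous_X K 2).mul hQ
  · intro i
    fin_cases i <;> rfl
  · simp only [dotProduct, Fin.sum_univ_three, s]
    simp only [cons_val_zero, cons_val_one, cons_val]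
    linear_combination Q * hE + CharTwo.add_self_eq_zero (C d * X 0 * X 1 * B)
  · intro x z h i
    have hz := h.1
    have hz0 : z ^ 2 * (d * x 1) + eval x (pderiv 0 B) = 0 := by simpa [h0] using h.2 0
    have hz1 : z ^ 2 * (d * x 0) + eval x (pderiv 1 B) = 0 := by simpa [h1] using h.2 1
    have hz2 : eval x (pderiv 2 B) = 0 := by simpa [h2] using h.2 2
    fin_cases i
    · simp [s]
      linear_combination eval x Q * hz0 + d * x 1 * hz -
        CharTwo.add_self_eq_zero (z ^ 2 * d * x 1 * eval x Q)
    · simp [s]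
      linear_combination eval x Q * hz1 + d * x 0 * hz -
        CharTwo.add_self_eq_zero (z ^ 2 * d * x 0 * eval x Q)
    · exact hz2
  · simp

/-- Here `z² x₀ x₁ = B` and `z² x₁ = ∂₀B` give `B = x₀ ∂₀B`, and likewise for `x₁`. These quartics
replace the quintics of the general elimination, and Euler's relation becomes a syzygy with constant
coefficients at both. -/
theorem encard_le_of_X_mul_X (hB : B.IsHomogeneous 4)
    (hfin : (singLocus (taylorForm (X 0 * X 1) 0 B)).Finite) :
    (singLocus (taylorForm (X 0 * X 1) 0 B)).encard ≤ 13 := by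
  have hinf : Infinite K := IsAlgClosed.instInfinite
  have hE := sum_X_mul_pderiv_eq_zero hB
  have hQ : (X 0 * X 1 : MvPolynomial (Fin 3) K).IsHomogeneous 2 :=
    (isHomogeneous_X K 0).mul (isHomogeneous_X K 1)
  have hc : ∀ a : K, a + a = 0 := CharTwo.add_self_eq_zero
  have h0 : pderiv 0 (X 0 * X 1 : MvPolynomial (Fin 3) K) = X 1 := by simp [pderiv_X]
  have h1 : pderiv 1 (X 0 * X 1 : MvPolynomial (Fin 3) K) = X 0 := by simp [pderiv_X]
  have h2 : pderiv 2 (X 0 * X 1 : MvPolynomial (Fin 3) K) = 0 := by simp [pderiv_X]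
  let s : Fin 3 → MvPolynomial (Fin 3) K :=
    ![B + X 0 * pderiv 0 B, pderiv 2 B, B + X 1 * pderiv 1 B]
  have hm : ∀ i, (s i).IsHomogeneous (![4, 3, 4] i) := fun i => by
    fin_cases i
    · exact hB.add ((isHomogeneous_X K 0).mul hB.pderiv)
    · exact hB.pderiv
    · exact hB.add ((isHomogeneous_X K 1).mul hB.pderiv)
  have hs : IsPrimitiveVec s := by
    by_contra hs
    obtain ⟨x, hx, hxx⟩ := exists_zero_family hm hs
    refine infinite_singLocus_of_family hQ hB hxx (infinite_setOf_ne_zero hxx) ?_ hfin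
    intro t ht
    have e0 : eval (x t) B + x t 0 * eval (x t) (pderiv 0 B) = 0 := by simpa [s] using hx t 0
    have e1 : eval (x t) B + x t 1 * eval (x t) (pderiv 1 B) = 0 := by simpa [s] using hx t 2
    have e2 : eval (x t) (pderiv 2 B) = 0 := by simpa [s] using hx t 1
    have hsing : ∀ w : K, w * (x t 0 * x t 1) + eval (x t) B = 0 →
        w * x t 1 + eval (x t) (pderiv 0 B) = 0 →
        w * x t 0 + eval (x t) (pderiv 1 B) = 0 → ∃ z, IsSingAt (X 0 * X 1) B (x t) z := by
      intro w a0 a1 a2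
      refine exists_isSingAt w (by simpa using a0) fun i => ?_
      fin_cases i
      · simpa only [Fin.zero_eta, h0, eval_X] using a1
      · simpa only [Fin.mk_one, h1, eval_X] using a2
      · simpa only [Fin.reduceFinMk, h2, map_zero, mul_zero, zero_add] using e2
    by_cases hx1 : x t 1 = 0
    · have hx0 : x t 0 ≠ 0 := ht.resolve_right (not_not.mpr hx1)
      refine hsing (eval (x t) (pderiv 1 B) / x t 0) ?_ ?_ ?_
      · field_simp
        linear_combination e1
      · field_simp
        linear_combination e0 + e1 - hc (eval (x t) B)
      · rw [div_mul_cancel₀ _ hx0, hc]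
    · refine hsing (eval (x t) (pderiv 0 B) / x t 1) ?_ ?_ ?_
      · field_simp
        linear_combination e0
      · rw [div_mul_cancel₀ _ hx1, hc]
      · field_simp
        linear_combination e0 + e1 - hc (eval (x t) B)
  refine encard_singLocus_le (N := 12) (p := ![1, X 2, 1]) (q := ![0, 1, 0]) (D := 4) hQ hB
    hfin hs (fun a ha => isUnit_of_dvd_one (ha 0)) hm ?_ ?_ ?_ ?_ ?_
  · intro i
    fin_cases i
    · exact isHomogeneous_one ..
    · exact isHomogeneous_X K 2
    · exact isHomogeneous_one ..
  · intro i
    fin_cases i <;> rfl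
  · simp only [dotProduct, Fin.sum_univ_three, s]
    simp only [cons_val_zero, cons_val_one, cons_val]
    linear_combination hE + CharTwo.add_self_eq_zero B
  · intro x z h i
    have hz : z ^ 2 * (x 0 * x 1) + eval x B = 0 := by simpa using h.1
    have hz0 : z ^ 2 * x 1 + eval x (pderiv 0 B) = 0 := by
      simpa only [h0, eval_X] using h.2 0
    have hz1 : z ^ 2 * x 0 + eval x (pderiv 1 B) = 0 := by
      simpa only [h1, eval_X] using h.2 1
    have hz2 : eval x (pderiv 2 B) = 0 := by
      simpa only [h2, map_zero, mul_zero, zero_add] using h.2 2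
    fin_cases i
    · simp [s]
      linear_combination hz + x 0 * hz0 - hc (z ^ 2 * x 0 * x 1)
    · exact hz2
    · simp [s]
      linear_combination hz + x 1 * hz1 - hc (z ^ 2 * x 0 * x 1)
  · simp

/-- As `d(l²) = 0`, only `∇B = 0` restricts `x`, and `z² = B / l²` lifts any zero with `l ≠ 0`. A
common factor of `∇B` must therefore be excluded separately along `l = 0`. -/
theorem encard_le_of_double_line {l : MvPolynomial (Fin 3) K} (hl : l.IsHomogeneous 1)
    (hl0 : l ≠ 0) (hB : B.IsHomogeneous 4) (hfin : (singLocus (taylorForm (l ^ 2) 0 B)).Finite) :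
    (singLocus (taylorForm (l ^ 2) 0 B)).encard ≤ 8 := by
  have hinf : Infinite K := IsAlgClosed.instInfinite
  have hE := sum_X_mul_pderiv_eq_zero hB
  have hQ : (l ^ 2).IsHomogeneous 2 := hl.pow 2
  have hd : ∀ i, pderiv i (l ^ 2) = 0 := fun i => by
    rw [pderiv_pow, Nat.cast_ofNat, CharTwo.two_eq_zero, zero_mul, zero_mul]
  let s : Fin 3 → MvPolynomial (Fin 3) K := fun i => pderiv i B
  have hm : ∀ i, (s i).IsHomogeneous (![3, 3, 3] i) := fun i => by
    fin_cases i <;> exact hB.pderiv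
  have hs : IsPrimitiveVec s := by
    by_contra hs
    obtain ⟨x, hx, hxx⟩ := exists_zero_family hm hs
    have hx0 : ∀ t, x t ≠ 0 := fun t h0 => hxx t (t + 1) (by simp) (by rw [h0]; simp)
    have hSfin : {t | eval (x t) l ≠ 0}.Finite := by
      by_contra hS
      refine infinite_singLocus_of_family hQ hB hxx hS (fun t ht => ?_) hfin
      refine exists_isSingAt (eval (x t) B / eval (x t) l ^ 2) ?_ fun i => ?_
      · rw [map_pow, div_mul_cancel₀ _ (pow_ne_zero 2 ht), CharTwo.add_self_eq_zero]
      · rw [hd, map_zero, mul_zero, zero_add]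
        exact hx t i
    have hSc : {t | eval (x t) l = 0}.Infinite := by
      convert hSfin.infinite_compl using 1
      ext t
      simp
    -- Infinitely many common zeros lie on `l`, so `l` divides every derivative of `B`. At a zero
    -- `y` of `B` on `l` all values of `z` are then singular, against uniqueness.
    have hdvd : ∀ i, l ∣ pderiv i B := fun i =>
      dvd_of_family hl hl0 hB.pderiv hxx hx0 hSc (fun t ht => ht) fun t => hx t i
    obtain ⟨t, ht, t', ht', hne⟩ := hSc.nontrivial
    obtain ⟨y, hy0, hyl, hyB⟩ : ∃ y : Fin 3 → K, y ≠ 0 ∧ eval y l = 0 ∧ eval y B = 0 := by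
      rcases exists_zero_on_line hB (by norm_num) (x t) (x t') with ⟨c, hc⟩ | h
      · refine ⟨_, fun h0 => ?_, ?_, hc⟩
        · have : x t = (-c) • x t' := by
            rw [neg_smul]
            exact eq_neg_of_add_eq_zero_left h0
          refine hxx t t' hne ?_
          rw [this]
          simp
        · obtain ⟨a, rfl⟩ := exists_eq_sum_of_isHomogeneous_one hl
          have h1 : eval (x t) (∑ k, C (a k) * X k) = 0 := ht
          have h2 : eval (x t') (∑ k, C (a k) * X k) = 0 := ht'
          simp only [Fin.sum_univ_three, map_add, map_mul, eval_C, eval_X, Pi.add_apply,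
            Pi.smul_apply, smul_eq_mul] at h1 h2 ⊢
          linear_combination h1 + c * h2
      · exact ⟨_, hx0 t', ht', h⟩
    have hall : ∀ z, IsSingAt (l ^ 2) B y z := fun z => by
      refine ⟨by rw [map_pow, hyl, hyB]; simp, fun i => ?_⟩
      obtain ⟨g, hg⟩ := hdvd i
      rw [hd, hg, map_mul, hyl]
      simp
    exact zero_ne_one (IsSingAt.unique hQ hB hfin hy0 (hall 0) (hall 1))
  refine encard_singLocus_le (N := 7) (p := X) (q := ![1, 1, 1]) (D := 4) hQ hB
    hfin hs (fun a ha => isUnit_of_dvd_X_of_dvd_X zero_ne_one (ha 0) (ha 1)) hm ?_ ?_ ?_ ?_ ?_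
  · intro i
    fin_cases i <;> exact isHomogeneous_X K _
  · intro i
    fin_cases i <;> rfl
  · simpa only [dotProduct, Fin.sum_univ_three] using hE
  · intro x z h i
    simpa [hd] using h.2 i
  · simp

end Cases

/-! ### Normal forms of `Q` and the bounds in arbitrary coordinates -/

section NormalForms

variable {K : Type*} [Field K]

theorem matSubst_X (M : Matrix (Fin 3) (Fin 3) K) (i : Fin 3) :
    matSubst M (X i) = C (M i 0) * X 0 + C (M i 1) * X 1 + C (M i 2) * X 2 := by
  rw [matSubst, bind₁_X_right, Matrix.toMvPolynomial, Fin.sum_univ_three]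
  simp only [C_mul_X_eq_monomial]

theorem matSubst_add (M : Matrix (Fin 3) (Fin 3) K) (f g : MvPolynomial (Fin 3) K) :
    matSubst M (f + g) = matSubst M f + matSubst M g := map_add (bind₁ _) _ _

theorem matSubst_mul (M : Matrix (Fin 3) (Fin 3) K) (f g : MvPolynomial (Fin 3) K) :
    matSubst M (f * g) = matSubst M f * matSubst M g := map_mul (bind₁ _) _ _

theorem matSubst_C (M : Matrix (Fin 3) (Fin 3) K) (c : K) : matSubst M (C c) = C c :=
  bind₁_C_right _ _

theorem matSubst_zero (M : Matrix (Fin 3) (Fin 3) K) : matSubst M 0 = 0 := map_zero (bind₁ _)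

/-- A ternary quadratic form in characteristic 2 is the square of a linear form or it can be
brought by a change of coordinates into the form `d x₁ x₂` plus a sum of squares. -/
theorem exists_nucleus_coordinates [IsAlgClosed K] [CharP K 2] {Q : MvPolynomial (Fin 3) K}
    (hQ : Q.IsHomogeneous 2) :
    (∃ l : MvPolynomial (Fin 3) K, l.IsHomogeneous 1 ∧ Q = l ^ 2) ∨
    ∃ (M : Matrix (Fin 3) (Fin 3) K) (d : K), IsUnit M.det ∧ d ≠ 0 ∧
      pderiv 0 (matSubst M Q) = C d * X 1 ∧ pderiv 1 (matSubst M Q) = C d * X 0 ∧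
      pderiv 2 (matSubst M Q) = 0 := by
  obtain ⟨a, b, c, d, e, f, rfl⟩ := exists_eq_of_isHomogeneous_two hQ
  set Q : MvPolynomial (Fin 3) K := C a * X 0 ^ 2 + C b * X 1 ^ 2 + C c * X 2 ^ 2 +
    C d * (X 0 * X 1) + C e * (X 0 * X 2) + C f * (X 1 * X 2) with hQdef
  have h2 : (2 : MvPolynomial (Fin 3) K) = 0 := CharTwo.two_eq_zero
  have d0 : pderiv 0 Q = C d * X 1 + C e * X 2 := by
    simp [hQdef, pderiv_X, h2]
  have d1 : pderiv 1 Q = C d * X 0 + C f * X 2 := by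
    simp [hQdef, pderiv_X, h2]
  have d2 : pderiv 2 Q = C e * X 0 + C f * X 1 := by
    simp [hQdef, pderiv_X, h2]
  by_cases hd : d = 0
  swap
  -- The polar form of `Q` is alternating on a 3-space, and its radical contains the nucleus `(f, e,
  -- d)`. This is the last column; the other two are basis vectors whose pairing is nonzero.
  · refine Or.inr ⟨!![1, 0, f; 0, 1, e; 0, 0, d], d, ?_, hd, ?_, ?_, ?_⟩
    · simpa [det_fin_three] using hd
    all_goals
      simp only [pderiv_matSubst, Fin.sum_univ_three, d0, d1, d2, matSubst_add, matSubst_mul,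
        matSubst_C, matSubst_X]
      simp
      grind
  by_cases hf : f = 0
  swap
  · refine Or.inr ⟨!![0, 0, f; 1, 0, e; 0, 1, d], f, ?_, hf, ?_, ?_, ?_⟩
    · simpa [det_fin_three] using hf
    all_goals
      simp only [pderiv_matSubst, Fin.sum_univ_three, d0, d1, d2, matSubst_add, matSubst_mul,
        matSubst_C, matSubst_X]
      simp
      grind
  by_cases he : e = 0
  swap
  · refine Or.inr ⟨!![1, 0, f; 0, 0, e; 0, 1, d], e, ?_, he, ?_, ?_, ?_⟩
    · simpa [det_fin_three] using he
    all_goals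
      simp only [pderiv_matSubst, Fin.sum_univ_three, d0, d1, d2, matSubst_add, matSubst_mul,
        matSubst_C, matSubst_X]
      simp
      grind
  left
  obtain ⟨α, rfl⟩ := IsAlgClosed.exists_pow_nat_eq a (n := 2) (by norm_num)
  obtain ⟨β, rfl⟩ := IsAlgClosed.exists_pow_nat_eq b (n := 2) (by norm_num)
  obtain ⟨γ, rfl⟩ := IsAlgClosed.exists_pow_nat_eq c (n := 2) (by norm_num)
  refine ⟨C α * X 0 + C β * X 1 + C γ * X 2, ((isHomogeneous_C_mul_X α 0).add
    (isHomogeneous_C_mul_X β 1)).add (isHomogeneous_C_mul_X γ 2), ?_⟩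
  rw [hQdef, hd, he, hf, add_pow_char, add_pow_char]
  simp only [map_zero, zero_mul, add_zero, mul_pow, map_pow]

theorem exists_matSubst_eq_X {l m : MvPolynomial (Fin 3) K} (hl : l.IsHomogeneous 1)
    (hm : m.IsHomogeneous 1) (h : LinearIndependent K ![l, m]) :
    ∃ M : Matrix (Fin 3) (Fin 3) K, IsUnit M.det ∧ matSubst M l = X 0 ∧ matSubst M m = X 1 := by
  obtain ⟨a, rfl⟩ := exists_eq_sum_of_isHomogeneous_one hl
  obtain ⟨b, rfl⟩ := exists_eq_sum_of_isHomogeneous_one hm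
  have hab : LinearIndependent K ![a, b] := by
    refine LinearIndependent.of_comp
      (Fintype.linearCombination K (X : Fin 3 → MvPolynomial (Fin 3) K)) ?_
    convert h using 1
    ext i : 1
    fin_cases i <;> simp [Fintype.linearCombination_apply, smul_eq_C_mul]
  -- The coordinate `X k` completes `l, m` to a system of coordinates: the determinant is the `k`-th
  -- entry of `a ⨯₃ b`.
  obtain ⟨k, hk⟩ := Function.ne_iff.mp (crossProduct_ne_zero_iff_linearIndependent.mpr hab)
  let A : Matrix (Fin 3) (Fin 3) K := ![a, b, Pi.single k 1]
  have hA : IsUnit A.det := by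
    rw [isUnit_iff_ne_zero]
    change det ![a, b, Pi.single k 1] ≠ 0
    rw [← triple_product_eq_det, triple_product_permutation, triple_product_permutation,
      single_one_dotProduct]
    exact hk
  have hrow : ∀ i, matSubst A⁻¹ (A.toMvPolynomial i) = X i := fun i => by
    rw [matSubst, ← toMvPolynomial_mul, mul_nonsing_inv _ hA, toMvPolynomial_one]
  refine ⟨A⁻¹, by simpa using hA, ?_, ?_⟩
  · rw [← hrow 0, Matrix.toMvPolynomial]
    simp only [C_mul_X_eq_monomial]
    rfl
  · rw [← hrow 1, Matrix.toMvPolynomial]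
    simp only [C_mul_X_eq_monomial]
    rfl

theorem encard_singLocus_taylorForm_matSubst {Q B : MvPolynomial (Fin 3) K}
    (hQ : Q.IsHomogeneous 2) (hB : B.IsHomogeneous 4) {M : Matrix (Fin 3) (Fin 3) K} (hM : IsUnit M.det) :
    (singLocus (taylorForm (matSubst M Q) 0 (matSubst M B))).encard =
      (singLocus (taylorForm Q 0 B)).encard := by
  rw [← encard_singLocus_matSubst (isHomogeneous_taylorForm hQ (isHomogeneous_zero ..) hB)
    (M := blockMatrix M) (by rwa [det_blockMatrix]), matSubst_blockMatrix_taylorForm,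
    matSubst_zero]

theorem encard_singLocus_of_isDoublePointWith {F : MvPolynomial (Fin 4) K}
    {P : Projectivization K (Fin 4 → K)} {Q G B : MvPolynomial (Fin 3) K}
    (hF : F.IsHomogeneous 4) (h : IsDoublePointWith F P Q G B) :
    (singLocus F).encard = (singLocus (taylorForm Q G B)).encard := by
  obtain ⟨-, -, -, -, g, -, hg⟩ := h
  rw [← hg, ← encard_singLocus_matSubst hF (M := g)
    ((isUnit_iff_isUnit_det _).mp g.isUnit)]
  rfl

variable [IsAlgClosed K] [CharP K 2] {Q B : MvPolynomial (Fin 3) K}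

theorem encard_singLocus_taylorForm_le (hQ : Q.IsHomogeneous 2) (hB : B.IsHomogeneous 4)
    (hQ0 : Q ≠ 0) (hfin : (singLocus (taylorForm Q 0 B)).Finite) :
    (singLocus (taylorForm Q 0 B)).encard ≤ 14 := by
  rcases exists_nucleus_coordinates hQ with ⟨l, hl, rfl⟩ | ⟨M, d, hM, hd, h0, h1, h2⟩
  · refine (encard_le_of_double_line hl ?_ hB hfin).trans (by norm_num)
    rintro rfl
    simp at hQ0
  · rw [← encard_singLocus_taylorForm_matSubst hQ hB hM]
    refine encard_le_of_nucleus (isHomogeneous_matSubst M hQ) (isHomogeneous_matSubst M hB) ?_ hd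
      h0 h1 h2
    rwa [← Set.encard_lt_top_iff, encard_singLocus_taylorForm_matSubst hQ hB hM,
      Set.encard_lt_top_iff]

theorem encard_singLocus_le_of_isLinePair (hQ : IsLinePair Q) (hB : B.IsHomogeneous 4)
    (hfin : (singLocus (taylorForm Q 0 B)).Finite) :
    (singLocus (taylorForm Q 0 B)).encard ≤ 13 := by
  obtain ⟨l, m, hl, hm, hlm, rfl⟩ := hQ
  obtain ⟨M, hM, h0, h1⟩ := exists_matSubst_eq_X hl hm hlm
  have he := encard_singLocus_taylorForm_matSubst (hl.mul hm) hB hM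
  rw [matSubst_mul, h0, h1] at he
  rw [← he]
  refine encard_le_of_X_mul_X (isHomogeneous_matSubst M hB) ?_
  rwa [← Set.encard_lt_top_iff, he, Set.encard_lt_top_iff]

theorem encard_singLocus_bounds {F : MvPolynomial (Fin 4) K}
    {P : Projectivization K (Fin 4 → K)} (hF : IsNormalQuartic F)
    (h : IsDoublePointWith F P Q 0 B) :
    (singLocus F).encard ≤ 14 ∧ (IsDoubleLine Q → (singLocus F).encard ≤ 8) ∧
      (IsLinePair Q → (singLocus F).encard ≤ 13) := by
  have he := encard_singLocus_of_isDoublePointWith hF.2.1 h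
  have hfin : (singLocus (taylorForm Q 0 B)).Finite := by
    rw [← Set.encard_lt_top_iff, ← he, Set.encard_lt_top_iff]
    exact hF.2.2
  obtain ⟨hQ, -, hB, hQ0, -⟩ := h
  rw [he]
  refine ⟨encard_singLocus_taylorForm_le hQ hB hQ0 hfin, ?_, fun hQ' =>
    encard_singLocus_le_of_isLinePair hQ' hB hfin⟩
  rintro ⟨l, hl, hl0, rfl⟩
  exact encard_le_of_double_line hl hl0 hB hfin

end NormalForms

/-! ### Counting projective points by normalized representatives -/

section Normalized

variable {K : Type*} [Field K]

/-- The first nonzero coordinate of `v` is `1`. -/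
def IsNormalized (v : Fin 4 → K) : Prop :=
  v 0 = 1 ∨ (v 0 = 0 ∧ v 1 = 1) ∨ (v 0 = 0 ∧ v 1 = 0 ∧ v 2 = 1) ∨
    (v 0 = 0 ∧ v 1 = 0 ∧ v 2 = 0 ∧ v 3 = 1)

theorem IsNormalized.ne_zero {v : Fin 4 → K} (h : IsNormalized v) : v ≠ 0 := by
  rintro rfl
  simp [IsNormalized] at h

theorem IsNormalized.eq_of_smul_eq {v w : Fin 4 → K} (hv : IsNormalized v) (hw : IsNormalized w)
    {a : K} (h : a • v = w) : v = w := by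
  have ha : a ≠ 0 := by
    rintro rfl
    exact hw.ne_zero (by rw [← h, zero_smul])
  suffices a = 1 by rwa [this, one_smul] at h
  subst h
  simp only [IsNormalized, Pi.smul_apply, smul_eq_mul, mul_eq_zero, ha, false_or] at hv hw
  grind

theorem exists_isNormalized_smul {v : Fin 4 → K} (hv : v ≠ 0) :
    ∃ c : K, c ≠ 0 ∧ IsNormalized (c • v) := by
  simp only [IsNormalized, Pi.smul_apply, smul_eq_mul]
  by_cases h0 : v 0 = 0
  · by_cases h1 : v 1 = 0
    · by_cases h2 : v 2 = 0
      · by_cases h3 : v 3 = 0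
        · exact absurd (by ext i; fin_cases i <;> assumption) hv
        · exact ⟨(v 3)⁻¹, inv_ne_zero h3, by simp [h0, h1, h2, h3]⟩
      · exact ⟨(v 2)⁻¹, inv_ne_zero h2, by simp [h0, h1, h2]⟩
    · exact ⟨(v 1)⁻¹, inv_ne_zero h1, by simp [h0, h1]⟩
  · exact ⟨(v 0)⁻¹, inv_ne_zero h0, by simp [h0]⟩

theorem encard_singLocus_eq_card {F : MvPolynomial (Fin 4) K} {d : ℕ} (hF : F.IsHomogeneous d)
    (V : Finset (Fin 4 → K)) (hV : ∀ v ∈ V, IsNormalized v)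
    (h : ∀ v, IsNormalized v → (IsSing F v ↔ v ∈ V)) : (singLocus F).encard = V.card := by
  let f : V → Projectivization K (Fin 4 → K) := fun v =>
    Projectivization.mk K v.1 (hV v v.2).ne_zero
  have hf : Function.Injective f := fun v w hvw => by
    obtain ⟨a, ha⟩ := (Projectivization.mk_eq_mk_iff' _ _ _ _ _).mp hvw
    exact Subtype.ext ((hV w w.2).eq_of_smul_eq (hV v v.2) ha).symm
  have hr : singLocus F = Set.range f := by
    ext p
    constructor
    · intro hp
      obtain ⟨c, hc, hn⟩ := exists_isNormalized_smul p.rep_nonzero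
      have hs : IsSing F (c • p.rep) := (isSing_smul_iff hF hc _).mpr hp
      refine ⟨⟨_, (h _ hn).mp hs⟩, ?_⟩
      conv_rhs => rw [← p.mk_rep]
      exact (Projectivization.mk_eq_mk_iff' _ _ _ _ _).mpr ⟨c, rfl⟩
    · rintro ⟨v, rfl⟩
      exact (mk_mem_singLocus_iff hF _ _).mpr ((h _ (hV v v.2)).mpr v.2)
  rw [hr, ← Set.image_univ, hf.encard_image, Set.encard_univ]
  simp

end Normalized

theorem vec_ext_iff {α : Type*} {v : Fin 4 → α} {a b c d : α} :
    v = ![a, b, c, d] ↔ v 0 = a ∧ v 1 = b ∧ v 2 = c ∧ v 3 = d := by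
  constructor
  · rintro rfl
    exact ⟨rfl, rfl, rfl, rfl⟩
  · rintro ⟨h0, h1, h2, h3⟩
    ext i
    fin_cases i <;> assumption

/-! ### The surface with 14 singular points -/

section Example

variable {K : Type*} [Field K]

/-- In characteristic 2 the roots differ by `b / a`, so `b ≠ 0` separates them, and `c ≠ 0` keeps
them away from zero. -/
theorem exists_two_roots [IsAlgClosed K] [CharP K 2] {a b c : K} (ha : a ≠ 0) (hb : b ≠ 0)
    (hc : c ≠ 0) : ∃ r r' : K, r ≠ r' ∧ r ≠ 0 ∧ r' ≠ 0 ∧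
      ∀ t, a * t ^ 2 + b * t + c = 0 ↔ t = r ∨ t = r' := by
  have h2 : (2 : K) = 0 := CharTwo.two_eq_zero
  obtain ⟨r, hr⟩ : ∃ r, a * r ^ 2 + b * r + c = 0 := by
    obtain ⟨r, hr⟩ := IsAlgClosed.exists_root
      (Polynomial.C a * Polynomial.X ^ 2 + Polynomial.C b * Polynomial.X + Polynomial.C c)
      (by rw [Polynomial.degree_quadratic ha]; norm_num)
    exact ⟨r, by simpa using hr⟩
  have key : ∀ t, a * t ^ 2 + b * t + c = 0 ↔ t = r ∨ t = r + b / a := fun t => by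
    have : a * t ^ 2 + b * t + c = a * ((t - r) * (t - (r + b / a))) := by
      field_simp
      grind
    rw [this]
    simp [ha, sub_eq_zero]
  refine ⟨r, r + b / a, ?_, ?_, ?_, key⟩
  · simp [ha, hb]
  · rintro rfl
    simp [hc] at hr
  · intro h
    have := (key (r + b / a)).mpr (Or.inr rfl)
    rw [h] at this
    simp [hc] at this

/-- The four points on one line, where `y₃ = c + a t` and the conic is `t²`. Either `z = 0` and `y₃
∈ {0, 1}`, or `z = t` is a root of `(1 + a²) t² + a t + c² + c`. The conditions on `a` and `c` keep
the four solutions distinct. -/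
theorem exists_finset_card_four [IsAlgClosed K] [CharP K 2] {a c : K} (ha : a ≠ 0) (ha1 : a ≠ 1)
    (hc : c ≠ 0) (hc1 : c ≠ 1) : ∃ S : Finset (K × K), S.card = 4 ∧ ∀ t z, (t, z) ∈ S ↔
      z ^ 2 = (c + a * t) ^ 2 + (c + a * t) ∧ z ^ 2 * (t ^ 2 + z ^ 2) = 0 := by
  classical
  have h2 : (2 : K) = 0 := CharTwo.two_eq_zero
  have ha2 : 1 + a ^ 2 ≠ 0 := fun h => ha1 (by
    have : (a - 1) ^ 2 = 0 := by linear_combination h - a * h2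
    exact sub_eq_zero.mp (pow_eq_zero_iff two_ne_zero |>.mp this))
  have hcc : c ^ 2 + c ≠ 0 := fun h => by
    have h' : c * (c - 1) = 0 := by linear_combination h - c * h2
    rcases mul_eq_zero.mp h' with h | h
    · exact hc h
    · exact hc1 (sub_eq_zero.mp h)
  have hsq : ∀ u v : K, u ^ 2 + v ^ 2 = 0 → u = v := fun u v h => by
    have h' : (u - v) ^ 2 = 0 := by linear_combination h - u * v * h2
    exact sub_eq_zero.mp (pow_eq_zero_iff two_ne_zero |>.mp h')
  obtain ⟨r, r', hrr, hr0, hr0', hr⟩ := exists_two_roots ha2 ha hcc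
  have hne : c / a ≠ (1 + c) / a := fun h => by
    field_simp at h
    simp at h
  refine ⟨{(c / a, 0), ((1 + c) / a, 0), (r, r), (r', r')}, ?_, fun t z => ?_⟩
  · rw [Finset.card_insert_of_notMem, Finset.card_insert_of_notMem, Finset.card_insert_of_notMem,
      Finset.card_singleton]
    · simp [hrr]
    · simp [hr0.symm, hr0'.symm]
    · simp [hr0.symm, hr0'.symm, hne]
  · simp only [Finset.mem_insert, Finset.mem_singleton, Prod.mk.injEq, eq_div_iff ha]
    constructor
    · rintro (⟨h, rfl⟩ | ⟨h, rfl⟩ | ⟨rfl, rfl⟩ | ⟨rfl, rfl⟩)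
      · grind
      · grind
      · have := (hr _).mpr (Or.inl rfl)
        grind
      · have := (hr _).mpr (Or.inr rfl)
        grind
    · rintro ⟨h, h'⟩
      rcases mul_eq_zero.mp h' with h' | h'
      · have hz : z = 0 := pow_eq_zero_iff two_ne_zero |>.mp h'
        rw [h'] at h
        have : (c + a * t) * (c + a * t - 1) = 0 := by linear_combination -h - (c + a * t) * h2
        rcases mul_eq_zero.mp this with h3 | h3
        · exact Or.inl ⟨by linear_combination h3 - c * h2, hz⟩
        · exact Or.inr (Or.inl ⟨by linear_combination h3 - c * h2, hz⟩)
      · obtain rfl := hsq t z h'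
        rcases (hr t).mp (by linear_combination h + (a * t + c ^ 2 + c + a ^ 2 * t ^2 + c * a * t) * h2) with h3 | h3
        · exact Or.inr (Or.inr (Or.inl ⟨h3, h3⟩))
        · exact Or.inr (Or.inr (Or.inr ⟨h3, h3⟩))

/-- The product runs over `y₃ + c` with `c` in the `𝔽₂`-span of `x₁, x₂`, so it is an additive
polynomial in `y₃`. -/
theorem fourLines_eq [CharP K 2] (a₁ a₂ a₃ : K) :
    fourLines a₁ a₂ a₃ = y3 a₁ a₂ a₃ ^ 4 +
      y3 a₁ a₂ a₃ ^ 2 * (X 0 ^ 2 + X 0 * X 1 + X 1 ^ 2) +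
      y3 a₁ a₂ a₃ * (X 0 ^ 2 * X 1 + X 0 * X 1 ^ 2) := by
  have h2 : (2 : MvPolynomial (Fin 3) K) = 0 := CharTwo.two_eq_zero
  unfold fourLines
  grind

/-- The `x₃`-derivative is `a₃ x₁ x₂ (x₁ + x₂)`. Its vanishing removes the term linear in `y₃` from
the equation and the terms with `a₁`, `a₂` from the other derivatives. -/
theorem isSingAt_example_iff [CharP K 2] {a₁ a₂ a₃ : K} (ha : a₃ ≠ 0) (x₁ x₂ x₃ z y : K)
    (hy : y = a₁ * x₁ + a₂ * x₂ + a₃ * x₃) :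
    IsSingAt (conic K) (fourLines a₁ a₂ a₃) ![x₁, x₂, x₃] z ↔
      x₁ * x₂ * (x₁ + x₂) = 0 ∧ x₂ * (z ^ 2 + y ^ 2 + y * x₂) = 0 ∧
      x₁ * (z ^ 2 + y ^ 2 + y * x₁) = 0 ∧
      z ^ 2 * (x₁ * x₂ + x₃ ^ 2) + y ^ 4 + y ^ 2 * (x₁ ^ 2 + x₁ * x₂ + x₂ ^ 2) = 0 := by
  have h2' : (2 : K) = 0 := CharTwo.two_eq_zero
  have h4' : (4 : K) = 0 := by linear_combination 2 * h2'
  have d0 : pderiv 0 (y3 a₁ a₂ a₃) = C a₁ := by simp [y3, pderiv_X]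
  have d1 : pderiv 1 (y3 a₁ a₂ a₃) = C a₂ := by simp [y3, pderiv_X]
  have d2 : pderiv 2 (y3 a₁ a₂ a₃) = C a₃ := by simp [y3, pderiv_X]
  have ey : eval ![x₁, x₂, x₃] (y3 a₁ a₂ a₃) = y := by simp [y3, hy]
  unfold IsSingAt
  rw [fourLines_eq, Fin.forall_fin_succ, Fin.forall_fin_succ, Fin.forall_fin_one]
  simp [conic, d0, d1, d2, ey, pderiv_X, h2', h4', -mul_eq_zero]
  constructor
  · rintro ⟨e0, e1, e2, e3⟩
    have e : x₁ ^ 2 * x₂ + x₁ * x₂ ^ 2 = 0 := (mul_eq_zero.mp e3).resolve_right ha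
    exact ⟨by linear_combination e, by linear_combination e1 - a₁ * e,
      by linear_combination e2 - a₂ * e, by linear_combination e0 - y * e⟩
  · rintro ⟨e, e1, e2, e0⟩
    exact ⟨by linear_combination e0 + y * e, by linear_combination e1 + a₁ * e,
      by linear_combination e2 + a₂ * e, by linear_combination a₃ * e⟩

theorem isSing_example_iff [CharP K 2] {a₁ a₂ a₃ : K} (ha : a₃ ≠ 0) (v : Fin 4 → K) :
    IsSing (taylorForm (conic K) 0 (fourLines a₁ a₂ a₃)) v ↔
      ∀ y, y = a₁ * v 0 + a₂ * v 1 + a₃ * v 2 →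
      v 0 * v 1 * (v 0 + v 1) = 0 ∧ v 1 * (v 3 ^ 2 + y ^ 2 + y * v 1) = 0 ∧
      v 0 * (v 3 ^ 2 + y ^ 2 + y * v 0) = 0 ∧
      v 3 ^ 2 * (v 0 * v 1 + v 2 ^ 2) + y ^ 4 +
        y ^ 2 * (v 0 ^ 2 + v 0 * v 1 + v 1 ^ 2) = 0 := by
  have hv : (Fin.snoc ![v 0, v 1, v 2] (v 3) : Fin 4 → K) = v := by
    ext i
    fin_cases i <;> rfl
  conv_lhs => rw [← hv]
  rw [isSing_taylorForm_iff]
  constructor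
  · intro h y hy
    exact (isSingAt_example_iff ha _ _ _ _ y hy).mp h
  · intro h
    exact (isSingAt_example_iff ha _ _ _ _ _ rfl).mpr (h _ rfl)

/-- On each of the lines `x₁ = 0`, `x₂ = 0`, `x₁ = x₂`, off the nucleus, a derivative reads `z² =
y₃² + y₃`. The equation then becomes `z² t² + z⁴ = 0`, with `t = x₃`, or `t = x₃ - 1` on the third
line, where the conic is `1 + x₃²`. -/
theorem singular_system_iff [CharP K 2] {a₁ a₂ a₃ x₁ x₂ x₃ z : K}
    (hv : x₁ = 1 ∨ (x₁ = 0 ∧ x₂ = 1) ∨ (x₁ = 0 ∧ x₂ = 0 ∧ x₃ = 1) ∨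
      (x₁ = 0 ∧ x₂ = 0 ∧ x₃ = 0 ∧ z = 1)) :
    (x₁ * x₂ * (x₁ + x₂) = 0 ∧
      x₂ * (z ^ 2 + (a₁ * x₁ + a₂ * x₂ + a₃ * x₃) ^ 2 + (a₁ * x₁ + a₂ * x₂ + a₃ * x₃) * x₂) = 0 ∧
      x₁ * (z ^ 2 + (a₁ * x₁ + a₂ * x₂ + a₃ * x₃) ^ 2 + (a₁ * x₁ + a₂ * x₂ + a₃ * x₃) * x₁) = 0 ∧
      z ^ 2 * (x₁ * x₂ + x₃ ^ 2) + (a₁ * x₁ + a₂ * x₂ + a₃ * x₃) ^ 4 +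
        (a₁ * x₁ + a₂ * x₂ + a₃ * x₃) ^ 2 * (x₁ ^ 2 + x₁ * x₂ + x₂ ^ 2) = 0) ↔
    (x₁ = 0 ∧ x₂ = 0 ∧ x₃ = 0 ∧ z = 1) ∨ (x₁ = 0 ∧ x₂ = 0 ∧ x₃ = 1 ∧ z = a₃ ^ 2) ∨
    (x₁ = 0 ∧ x₂ = 1 ∧ z ^ 2 = (a₂ + a₃ * x₃) ^ 2 + (a₂ + a₃ * x₃) ∧
      z ^ 2 * (x₃ ^ 2 + z ^ 2) = 0) ∨
    (x₁ = 1 ∧ x₂ = 0 ∧ z ^ 2 = (a₁ + a₃ * x₃) ^ 2 + (a₁ + a₃ * x₃) ∧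
      z ^ 2 * (x₃ ^ 2 + z ^ 2) = 0) ∨
    (x₁ = 1 ∧ x₂ = 1 ∧
      z ^ 2 = (a₁ + a₂ + a₃ + a₃ * (x₃ - 1)) ^ 2 + (a₁ + a₂ + a₃ + a₃ * (x₃ - 1)) ∧
      z ^ 2 * ((x₃ - 1) ^ 2 + z ^ 2) = 0) := by
  have h2 : (2 : K) = 0 := CharTwo.two_eq_zero
  constructor
  · rintro ⟨e, e1, e2, e0⟩
    rcases hv with rfl | ⟨rfl, rfl⟩ | ⟨rfl, rfl, rfl⟩ | ⟨rfl, rfl, rfl, rfl⟩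
    · have hx : x₂ * (1 + x₂) = 0 := by linear_combination e
      rcases mul_eq_zero.mp hx with rfl | hx
      · refine Or.inr (Or.inr (Or.inr (Or.inl ⟨rfl, rfl, ?_, ?_⟩))) <;> grind
      · obtain rfl : x₂ = 1 := by linear_combination hx - h2
        refine Or.inr (Or.inr (Or.inr (Or.inr ⟨rfl, rfl, ?_, ?_⟩))) <;> grind
    · refine Or.inr (Or.inr (Or.inl ⟨rfl, rfl, ?_, ?_⟩)) <;> grind
    · refine Or.inr (Or.inl ⟨rfl, rfl, rfl, ?_⟩)
      have h' : (z - a₃ ^ 2) ^ 2 = 0 := by linear_combination e0 - z * a₃ ^ 2 * h2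
      exact sub_eq_zero.mp (pow_eq_zero_iff two_ne_zero |>.mp h')
    · exact Or.inl ⟨rfl, rfl, rfl, rfl⟩
  · rintro (⟨rfl, rfl, rfl, rfl⟩ | ⟨rfl, rfl, rfl, rfl⟩ | ⟨rfl, rfl, h, h'⟩ | ⟨rfl, rfl, h, h'⟩ |
      ⟨rfl, rfl, h, h'⟩)
    · simp
    · refine ⟨?_, ?_, ?_, ?_⟩ <;> grind
    · refine ⟨?_, ?_, ?_, ?_⟩ <;> grind
    · refine ⟨?_, ?_, ?_, ?_⟩ <;> grind
    · refine ⟨?_, ?_, ?_, ?_⟩ <;> grind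

theorem isHomogeneous_conic : (conic K).IsHomogeneous 2 :=
  ((isHomogeneous_X K 0).mul (isHomogeneous_X K 1)).add ((isHomogeneous_X K 2).pow 2)

theorem isHomogeneous_fourLines (a₁ a₂ a₃ : K) : (fourLines a₁ a₂ a₃).IsHomogeneous 4 := by
  have hy : (y3 a₁ a₂ a₃).IsHomogeneous 1 :=
    ((isHomogeneous_C_mul_X a₁ 0).add (isHomogeneous_C_mul_X a₂ 1)).add
      (isHomogeneous_C_mul_X a₃ 2)
  exact (((hy.add (isHomogeneous_X K 0)).mul (hy.add (isHomogeneous_X K 1))).mul hy).mul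
    ((hy.add (isHomogeneous_X K 0)).add (isHomogeneous_X K 1))

theorem encard_singLocus_example [IsAlgClosed K] [CharP K 2] {a₁ a₂ a₃ : K}
    (h : IsGeneral a₁ a₂ a₃) :
    (singLocus (taylorForm (conic K) 0 (fourLines a₁ a₂ a₃))).encard = 14 := by
  classical
  have h2 : (2 : K) = 0 := CharTwo.two_eq_zero
  obtain ⟨h30, h31, h10, h11, h20, h21, hs0, hs1⟩ := h
  obtain ⟨S₁, hc₁, hS₁⟩ := exists_finset_card_four h30 h31 h20 h21
  obtain ⟨S₂, hc₂, hS₂⟩ := exists_finset_card_four h30 h31 h10 h11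
  obtain ⟨S₃, hc₃, hS₃⟩ := exists_finset_card_four h30 h31 hs0 hs1
  let f₁ : K × K → Fin 4 → K := fun p => ![0, 1, p.1, p.2]
  let f₂ : K × K → Fin 4 → K := fun p => ![1, 0, p.1, p.2]
  let f₃ : K × K → Fin 4 → K := fun p => ![1, 1, 1 + p.1, p.2]
  have hf₁ : Function.Injective f₁ := fun p q hpq =>
    Prod.ext (congrFun hpq 2) (congrFun hpq 3)
  have hf₂ : Function.Injective f₂ := fun p q hpq =>
    Prod.ext (congrFun hpq 2) (congrFun hpq 3)
  have hf₃ : Function.Injective f₃ := fun p q hpq =>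
    Prod.ext (add_left_cancel (congrFun hpq 2)) (congrFun hpq 3)
  -- The vertex and the singular point over the nucleus `(0, 0, 1)` of the conic.
  let V₀ : Finset (Fin 4 → K) := {![0, 0, 0, 1], ![0, 0, 1, a₃ ^ 2]}
  have hV₀ : V₀.card = 2 := Finset.card_pair fun h => by simpa using congrFun h 2
  let V : Finset (Fin 4 → K) := ((V₀ ∪ S₁.image f₁) ∪ S₂.image f₂) ∪ S₃.image f₃
  have hmem : ∀ v, v ∈ V ↔ v = ![0, 0, 0, 1] ∨ v = ![0, 0, 1, a₃ ^ 2] ∨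
      (v 0 = 0 ∧ v 1 = 1 ∧ (v 2, v 3) ∈ S₁) ∨ (v 0 = 1 ∧ v 1 = 0 ∧ (v 2, v 3) ∈ S₂) ∨
      (v 0 = 1 ∧ v 1 = 1 ∧ (v 2 - 1, v 3) ∈ S₃) := fun v => by
    have e₁ : v ∈ S₁.image f₁ ↔ (v 0 = 0 ∧ v 1 = 1 ∧ (v 2, v 3) ∈ S₁) := by
      rw [Finset.mem_image]
      constructor
      · rintro ⟨p, hp, rfl⟩
        exact ⟨rfl, rfl, hp⟩
      · rintro ⟨h0, h1, hp⟩
        exact ⟨_, hp, (vec_ext_iff.mpr ⟨h0, h1, rfl, rfl⟩).symm⟩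
    have e₂ : v ∈ S₂.image f₂ ↔ (v 0 = 1 ∧ v 1 = 0 ∧ (v 2, v 3) ∈ S₂) := by
      rw [Finset.mem_image]
      constructor
      · rintro ⟨p, hp, rfl⟩
        exact ⟨rfl, rfl, hp⟩
      · rintro ⟨h0, h1, hp⟩
        exact ⟨_, hp, (vec_ext_iff.mpr ⟨h0, h1, rfl, rfl⟩).symm⟩
    have e₃ : v ∈ S₃.image f₃ ↔ (v 0 = 1 ∧ v 1 = 1 ∧ (v 2 - 1, v 3) ∈ S₃) := by
      rw [Finset.mem_image]
      constructor
      · rintro ⟨p, hp, rfl⟩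
        exact ⟨rfl, rfl, by simpa [f₃] using hp⟩
      · rintro ⟨h0, h1, hp⟩
        exact ⟨_, hp, (vec_ext_iff.mpr ⟨h0, h1, by simp, rfl⟩).symm⟩
    simp only [V, V₀, Finset.mem_union, e₁, e₂, e₃, Finset.mem_insert, Finset.mem_singleton,
      or_assoc]
  have hcard : V.card = 14 := by
    rw [Finset.card_union_of_disjoint, Finset.card_union_of_disjoint,
      Finset.card_union_of_disjoint, Finset.card_image_of_injective _ hf₁,
      Finset.card_image_of_injective _ hf₂, Finset.card_image_of_injective _ hf₃,
      hV₀, hc₁, hc₂, hc₃]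
    all_goals
      rw [Finset.disjoint_left]
      simp only [V₀, f₁, f₂, f₃, Finset.mem_union, Finset.mem_image, Finset.mem_insert,
        Finset.mem_singleton, vec_ext_iff]
      rintro v hv ⟨p, -, rfl⟩
      simp at hv
  rw [encard_singLocus_eq_card (isHomogeneous_taylorForm isHomogeneous_conic
    (isHomogeneous_zero ..) (isHomogeneous_fourLines a₁ a₂ a₃)) V, hcard]
  · rfl
  · intro v hv
    rw [hmem, vec_ext_iff, vec_ext_iff] at hv
    unfold IsNormalized
    tauto
  · intro v hv
    rw [hmem, vec_ext_iff, vec_ext_iff, hS₁, hS₂, hS₃, isSing_example_iff h30, forall_eq]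
    exact singular_system_iff hv

end Example

/-! ### General parameters, the double point and normality of the example -/

theorem exists_isGeneral (K : Type*) [Field K] [Infinite K] [CharP K 2] :
    ∃ a₁ a₂ a₃ : K, IsGeneral a₁ a₂ a₃ := by
  classical
  obtain ⟨t, ht⟩ := Infinite.exists_notMem_finset ({0, 1} : Finset K)
  simp only [Finset.mem_insert, Finset.mem_singleton, not_or] at ht
  -- Equal parameters suffice, since `t + t + t = t`.
  refine ⟨t, t, t, ht.1, ht.2, ht.1, ht.2, ht.1, ht.2, ?_, ?_⟩ <;>
    rw [CharTwo.add_self_eq_zero, zero_add]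
  exacts [ht.1, ht.2]

theorem isDoublePointWith_taylorForm {K : Type*} [Field K] {Q G B : MvPolynomial (Fin 3) K}
    (hQ : Q.IsHomogeneous 2) (hG : G.IsHomogeneous 3) (hB : B.IsHomogeneous 4) (hQ0 : Q ≠ 0) :
    IsDoublePointWith (taylorForm Q G B) (vertex K) Q G B := by
  refine ⟨hQ, hG, hB, hQ0, 1, ?_, ?_⟩
  · rw [Units.val_one, one_mulVec, vertex, Projectivization.submodule_mk]
    exact Submodule.mem_span_singleton_self _
  · rw [Units.val_one, linSubst, toMvPolynomial_one, bind₁_X_left]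
    rfl

theorem taylorForm_ne_zero {K : Type*} [Field K] [CharP K 2] {Q B : MvPolynomial (Fin 3) K}
    (h : ¬ (∀ x z, IsSingAt Q B x z)) : taylorForm Q 0 B ≠ 0 := by
  intro h0
  refine h fun x z => ?_
  rw [← isSing_taylorForm_iff, h0]
  exact ⟨map_zero _, fun i => by simp⟩

theorem conic_ne_zero (K : Type*) [Field K] : conic K ≠ 0 := by
  intro h
  have := congrArg (eval ![0, 0, 1]) h
  simp [conic] at this

theorem isNormalQuartic_example {K : Type*} [Field K] [IsAlgClosed K] [CharP K 2] {a₁ a₂ a₃ : K}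
    (h : IsGeneral a₁ a₂ a₃) :
    IsNormalQuartic (taylorForm (conic K) 0 (fourLines a₁ a₂ a₃)) := by
  refine ⟨taylorForm_ne_zero fun hall => ?_, isHomogeneous_taylorForm isHomogeneous_conic
    (isHomogeneous_zero ..) (isHomogeneous_fourLines a₁ a₂ a₃), ?_⟩
  -- Were the quartic zero, all points over `(1, 0, 0)` would be singular, although the equation
  -- there determines `z²`.
  · have hz : ∀ z : K, 1 * (z ^ 2 + a₁ ^ 2 + a₁ * 1) = 0 := fun z =>
      ((isSingAt_example_iff h.1 1 0 0 z a₁ (by ring)).mp (hall _ _)).2.2.1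
    exact one_ne_zero (by linear_combination hz 1 - hz 0 : (1 : K) = 0)
  · rw [← Set.encard_lt_top_iff, encard_singLocus_example h]
    exact ENat.natCast_lt_top 14

end QuarticChar2
end

theorem mainTheorem2 {K : Type*} [Field K] [IsAlgClosed K] [CharP K 2] :
    (∀ (F : MvPolynomial (Fin 4) K) (P : Projectivization K (Fin 4 → K))
        (Q G B : MvPolynomial (Fin 3) K),
        QuarticChar2.IsNormalQuartic F →
        QuarticChar2.IsDoublePointWith F P Q G B →
        G = 0 →
          (QuarticChar2.singLocus F).encard ≤ 16 ∧
          (QuarticChar2.IsDoubleLine Q → (QuarticChar2.singLocus F).encard ≤ 8) ∧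
          (QuarticChar2.IsLinePair Q → (QuarticChar2.singLocus F).encard ≤ 13)) ∧
    (∃ a₁ a₂ a₃ : K, QuarticChar2.IsGeneral a₁ a₂ a₃) ∧
    (∀ a₁ a₂ a₃ : K, QuarticChar2.IsGeneral a₁ a₂ a₃ →
        ∀ F : MvPolynomial (Fin 4) K,
        F = QuarticChar2.taylorForm (QuarticChar2.conic K) 0
          (QuarticChar2.fourLines a₁ a₂ a₃) →
          QuarticChar2.IsNormalQuartic F ∧
          QuarticChar2.IsDoublePointWith F (QuarticChar2.vertex K) (QuarticChar2.conic K) 0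
            (QuarticChar2.fourLines a₁ a₂ a₃) ∧
          (QuarticChar2.singLocus F).encard = 14) := by
  have hinf : Infinite K := IsAlgClosed.instInfinite
  refine ⟨?_, QuarticChar2.exists_isGeneral K, ?_⟩
  · rintro F P Q G B hF hP rfl
    obtain ⟨h1, h2, h3⟩ := QuarticChar2.encard_singLocus_bounds hF hP
    exact ⟨h1.trans (by norm_num), h2, h3⟩
  · rintro a₁ a₂ a₃ h F rfl
    exact ⟨QuarticChar2.isNormalQuartic_example h,
      QuarticChar2.isDoublePointWith_taylorForm QuarticChar2.isHomogeneous_conic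
        (isHomogeneous_zero ..) (QuarticChar2.isHomogeneous_fourLines a₁ a₂ a₃)
        (QuarticChar2.conic_ne_zero K), QuarticChar2.encard_singLocus_example h⟩
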